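/- \textbf{Setting.} Let $n\ge 0$ be the dimension, let $\Xi$ be a (standard Borel) noise space, $P$ a probability measure on $\Xi$, and $F:\mathbb R^n\times\Xi\to\mathbb R$ a Borel function such that $F(x,\cdot)$ is $P$-integrable for every $x$. Let $f(x)=\int_\Xi F(x,\xi)\,dP(\xi)$ be bounded below, with $f^*=\inf_{x\in\mathbb R^n} f(x)$. Let $L>0$, $\sigma\ge 0$, $\tilde D>0$ and $x_1\in\mathbb R^n$. Assume that, $P$-almost surely, $F(\cdot,\xi)$ is differentiable with $L$-Lipschitz gradient, and write $G(x,\xi)=\nabla_xF(x,\xi)$. Only values of $F$ are available: a call of the stochastic zeroth-order oracle with input $(x,\xi)$ returns $F(x,\xi)$. Put $D_f=[2(f(x_1)-f^*)/L]^{1/2}$ and, for integers $N\ge1$, $$\bar{\mathcal B}_N=\frac{12(n+4)LD_f^2}{N}+\frac{4\sigma\sqrt{n+4}}{\sqrt N}\Big(\tilde D+\frac{D_f^2}{\tilde D}\Big),\qquad \gamma_k=\frac1{\sqrt{n+4}}\min\Big\{\frac1{4L\sqrt{n+4}},\frac{\tilde D}{\sigma\sqrt N}\Big\}\quad(1\le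 k\le N),$$ where $\tilde D/(\sigma\sqrt N)=+\infty$ if $\sigma=0$. Let the smoothing parameter satisfy $0<\mu\le D_f/((n+4)\sqrt{2N})$ (so $D_f>0$), and let $G_\mu(x,\xi,u)=\frac{F(x+\mu u,\xi)-F(x,\xi)}{\mu}\,u$, which costs two oracle calls. \textbf{RSGF run.} Draw $R\in\{1,\dots,N\}$ with $\mathrm{Prob}\{R=k\}=\frac{\gamma_k-2L(n+4)\gamma_k^2}{\sum_{j=1}^N[\gamma_j-2L(n+4)\gamma_j^2]}$; for $k=1,\dots,R$ draw $\xi_k$ and $u_k$, compute $G_\mu(x_k,\xi_k,u_k)$ and set $x_{k+1}=x_k-\gamma_kG_\mu(x_k,\xi_k,u_k)$; output $x_R$. \textbf{2-RSGF method} with integers $S,N,T\ge1$. Optimization phase: $S$ RSGF runs from $x_1$ give $\bar x_1,\dots,\bar x_S$. Post-optimization phase: for every $s$ compute $g_\mu(\bar x_s)=\frac1T\sum_{k=1}^TG_\mu(\bar x_s,\xi_k,u_k)$ from new samples (which may or may not be shared by the different $s$), and output a candidate $\bar x^*\in\{\bar x_1,\dots,\bar x_S\}$ with $\|g_\mu(\bar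 x^*)\|=\min_s\|g_\mu(\bar x_s)\|$, ties being broken measurably in any way. \textbf{Sampling.} The history of a sample in a run consists of all previous runs and the previous samples of that run; the history of a sample in the post-optimization phase consists of the optimization phase and the previous samples for the same candidate. Every direction $u$ is an $n$-dimensional standard Gaussian vector, independent of its history together with the $\xi$ of the same iteration; every $R$ is independent of the previous runs and of the samples of its run. For every $\xi$, almost surely under its conditional law given its history, $F(\cdot,\xi)$ is differentiable with $L$-Lipschitz gradient, and, conditionally on the history, for all $x\in\mathbb R^n$ (expectations being finite): $\mathbb E[F(x,\xi)]=f(x)$, $\mathbb E[G(x,\xi)]=\nabla f(x)$ and $\mathbb E\|G(x,\xi)-\nabla f(x)\|^2\le\sigma^2$. (The $\xi$'s need not be independent of the past.) \textbf{Theorem.} (a) For all integers $S,N,T\ge1$ and all $\lambda>0$, $$\mathrm{Prob}\Big\{\|\nabla f(\bar x^*)\|^2\ge 8L\bar{\mathcal B}_N+\frac{3(n+4)L^2D_f^2}{2N}+\frac{24(n+4)\lambda}{T}\Big[L\bar{\mathcal B}_N+\frac{(n+4)L^2D_f^2}{N}+\sigma^2\Big]\Big\}\le\frac{S+1}{\lambda}+2^{-S}.$$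 (b) Let $\epsilon>0$ and $\Lambda\in(0,1)$, and let $S=S(\Lambda)=\lceil\log_2(2/\Lambda)\rceil$, $$N=\hat N(\epsilon)=\Big\lceil\max\Big\{\frac{12(n+4)(6LD_f)^2}{\epsilon},\Big[72L\sqrt{n+4}\Big(\tilde D+\frac{D_f^2}{\tilde D}\Big)\frac{\sigma}{\epsilon}\Big]^2\Big\}\Big\rceil,\qquad T=\hat T(\epsilon,\Lambda)=\Big\lceil\frac{24(n+4)(S+1)}{\Lambda}\max\Big\{1,\frac{6\sigma^2}{\epsilon}\Big\}\Big\rceil .$$ Then $\bar x^*$ is an $(\epsilon,\Lambda)$-solution, i.e. $\mathrm{Prob}\{\|\nabla f(\bar x^*)\|^2\le\epsilon\}\ge1-\Lambda$, and the method makes at most $2S(\Lambda)[\hat N(\epsilon)+\hat T(\epsilon,\Lambda)]$ oracle calls. -/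

import Mathlib

open MeasureTheory ProbabilityTheory

/-- The class `C_L^{1,1}`: differentiable with `L`-Lipschitz gradient. -/
def IsC11 {n : ℕ} (L : ℝ) (g : EuclideanSpace ℝ (Fin n) → ℝ) : Prop :=
  Differentiable ℝ g ∧ ∀ x y, ‖gradient g y - gradient g x‖ ≤ L * ‖y - x‖

/-- The objective `f(x) = ∫ F(x, ξ) dP(ξ)`. -/
noncomputable def objective {n : ℕ} {Ξ : Type*} [MeasurableSpace Ξ]
    (F : EuclideanSpace ℝ (Fin n) → Ξ → ℝ) (P : Measure Ξ) : EuclideanSpace ℝ (Fin n) → ℝ :=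
  fun x => ∫ ξ, F x ξ ∂P

/-- The oracle assumptions on a law `Q` of the noise `ξ`, at every input point `x`, where
`G(x, ξ)` is the gradient of `F(·, ξ)` at `x`. -/
structure OracleLaw {n : ℕ} {Ξ : Type*} [MeasurableSpace Ξ]
    (F : EuclideanSpace ℝ (Fin n) → Ξ → ℝ) (f : EuclideanSpace ℝ (Fin n) → ℝ)
    (L σ : ℝ) (Q : Measure Ξ) : Prop where
  /-- `F(·, ξ)` is almost surely of class `C_L^{1,1}`. -/
  smooth : ∀ᵐ ξ ∂Q, IsC11 L (fun x => F x ξ)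
  /-- The zeroth-order oracle is unbiased: `E[F(x, ξ)] = f(x)`. -/
  value_integrable : ∀ x, Integrable (F x) Q
  value_mean : ∀ x, ∫ ξ, F x ξ ∂Q = f x
  /-- The stochastic gradient is unbiased: `E[G(x, ξ)] = ∇ f(x)`. -/
  grad_integrable : ∀ x, Integrable (fun ξ => gradient (fun y => F y ξ) x) Q
  grad_mean : ∀ x, ∫ ξ, gradient (fun y => F y ξ) x ∂Q = gradient f x
  /-- `E[‖G(x, ξ) - ∇ f(x)‖²] ≤ σ²`. -/
  var_integrable : ∀ x, Integrable (fun ξ => ‖gradient (fun y => F y ξ) x - gradient f x‖ ^ 2) Q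
  var_le : ∀ x, ∫ ξ, ‖gradient (fun y => F y ξ) x - gradient f x‖ ^ 2 ∂Q ≤ σ ^ 2

/-! ### Algorithms with access to a zeroth-order oracle -/

/-- A procedure that sees `F` only through calls to the oracle: `ask x ξ next` submits the input
`(x, ξ)` and continues with `next (F x ξ)`. -/
inductive OracleProg (E Ξ α : Type*) where
  | ret (a : α) : OracleProg E Ξ α
  | ask (x : E) (ξ : Ξ) (next : ℝ → OracleProg E Ξ α) : OracleProg E Ξ α

namespace OracleProg

variable {E Ξ α β : Type*}

/-- Sequential composition. -/
def bind : OracleProg E Ξ α → (α → OracleProg E Ξ β) → OracleProg E Ξ β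
  | ret a, g => g a
  | ask x ξ next, g => ask x ξ (fun y => bind (next y) g)

/-- The output when the oracle returns the values of `F`. -/
def output (F : E → Ξ → ℝ) : OracleProg E Ξ α → α
  | ret a => a
  | ask x ξ next => output F (next (F x ξ))

/-- The number of oracle calls made when the oracle returns the values of `F`. -/
def calls (F : E → Ξ → ℝ) : OracleProg E Ξ α → ℕ
  | ret _ => 0
  | ask x ξ next => calls F (next (F x ξ)) + 1

/-- Run the procedures `p 0, …, p (m - 1)` one after another and collect their outputs. -/
def collect : (m : ℕ) → (Fin m → OracleProg E Ξ α) → OracleProg E Ξ (Fin m → α)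
  | 0, _ => ret Fin.elim0
  | m + 1, p => (p 0).bind fun a => (collect m fun i => p i.succ).bind fun b => ret (Fin.cons a b)

end OracleProg

/-- The estimator `G_μ(x, ξ, u) = ((F(x + μ u, ξ) - F(x, ξ)) / μ) u`, at two oracle calls. -/
noncomputable def gradEstimate {n : ℕ} {Ξ : Type*} (μ : ℝ) (x : EuclideanSpace ℝ (Fin n)) (ξ : Ξ)
    (u : EuclideanSpace ℝ (Fin n)) :
    OracleProg (EuclideanSpace ℝ (Fin n)) Ξ (EuclideanSpace ℝ (Fin n)) :=
  .ask (x + μ • u) ξ fun a => .ask x ξ fun b => .ret (((a - b) / μ) • u)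

/-- The first `k` iterations of the RSGF method; the output is the iterate `x_{k+1}`.
The `(k+1)`-st iteration uses `γ (k+1)` and the samples `ξ k`, `u k`. -/
noncomputable def rsgfSteps {n : ℕ} {Ξ : Type*} (γ : ℕ → ℝ) (μ : ℝ)
    (x₁ : EuclideanSpace ℝ (Fin n)) (ξ : ℕ → Ξ) (u : ℕ → EuclideanSpace ℝ (Fin n)) :
    ℕ → OracleProg (EuclideanSpace ℝ (Fin n)) Ξ (EuclideanSpace ℝ (Fin n))
  | 0 => .ret x₁
  | k + 1 => (rsgfSteps γ μ x₁ ξ u k).bind fun x =>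
      (gradEstimate μ x (ξ k) (u k)).bind fun g => .ret (x - γ (k + 1) • g)

/-- The RSGF method with iteration count `R ≥ 1`: iterations `1, …, R` are carried out, the last
one with its own call of the estimator, and the output is `x_R`. -/
noncomputable def rsgf {n : ℕ} {Ξ : Type*} (γ : ℕ → ℝ) (μ : ℝ) (x₁ : EuclideanSpace ℝ (Fin n))
    (ξ : ℕ → Ξ) (u : ℕ → EuclideanSpace ℝ (Fin n)) (R : ℕ) :
    OracleProg (EuclideanSpace ℝ (Fin n)) Ξ (EuclideanSpace ℝ (Fin n)) :=
  (rsgfSteps γ μ x₁ ξ u (R - 1)).bind fun x =>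
    (gradEstimate μ x (ξ (R - 1)) (u (R - 1))).bind fun _ => .ret x

/-- The averaged estimator `g_μ(x) = (1/T) ∑_k G_μ(x, ξ_k, u_k)`. -/
noncomputable def avgGradEstimate {n : ℕ} {Ξ : Type*} (μ : ℝ) (T : ℕ)
    (x : EuclideanSpace ℝ (Fin n)) (ξ : ℕ → Ξ) (u : ℕ → EuclideanSpace ℝ (Fin n)) :
    OracleProg (EuclideanSpace ℝ (Fin n)) Ξ (EuclideanSpace ℝ (Fin n)) :=
  (OracleProg.collect T fun k => gradEstimate μ x (ξ k) (u k)).bind fun g =>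
    .ret ((1 / (T : ℝ)) • ∑ k, g k)

/-- The random inputs of the two-phase method: `ξ s k`, `u s k` and the iteration count `R s` in
run `s` of the optimization phase; `ξ' s k`, `u' s k` in the post-optimization phase, for the
estimate at the candidate number `s`. Runs and samples are numbered from `0`, and only
`s < S`, `k < N` (respectively `k < T`) are used. -/
structure Draws (n : ℕ) (Ξ Ω : Type*) where
  ξ : ℕ → ℕ → Ω → Ξ
  u : ℕ → ℕ → Ω → EuclideanSpace ℝ (Fin n)
  R : ℕ → Ω → ℕ
  ξ' : ℕ → ℕ → Ω → Ξ
  u' : ℕ → ℕ → Ω → EuclideanSpace ℝ (Fin n)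

/-- The 2-RSGF method on the random inputs `d` at `ω`. The argument `pick` selects the index of
the output from the list of the averaged gradient estimates. -/
noncomputable def twoRSGF {n : ℕ} {Ξ Ω : Type*} (γ : ℕ → ℝ) (μ : ℝ)
    (x₁ : EuclideanSpace ℝ (Fin n)) (S T : ℕ) (d : Draws n Ξ Ω) (ω : Ω)
    (pick : (Fin S → EuclideanSpace ℝ (Fin n)) → Fin S) :
    OracleProg (EuclideanSpace ℝ (Fin n)) Ξ (EuclideanSpace ℝ (Fin n)) :=
  (OracleProg.collect S fun s =>
      rsgf γ μ x₁ (fun k => d.ξ s k ω) (fun k => d.u s k ω) (d.R s ω)).bind fun x =>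
    (OracleProg.collect S fun s =>
        avgGradEstimate μ T (x s) (fun k => d.ξ' s k ω) (fun k => d.u' s k ω)).bind fun g =>
      .ret (x (pick g))

/-- `pick` selects an index with the smallest norm; ties may be broken in any measurable way,
possibly at random. -/
structure IsMinNormPick {n : ℕ} {Ω : Type*} [MeasurableSpace Ω] {S : ℕ}
    (pick : Ω → (Fin S → EuclideanSpace ℝ (Fin n)) → Fin S) : Prop where
  measurable : Measurable (Function.uncurry pick)
  norm_le : ∀ (ω : Ω) (g : Fin S → EuclideanSpace ℝ (Fin n)) (s : Fin S), ‖g (pick ω g)‖ ≤ ‖g s‖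

/-! ### Parameters -/

/-- `D_f = (2 (f(x₁) - f^*) / L)^{1/2}` with `f^* = inf f`. -/
noncomputable def Dgap {n : ℕ} (f : EuclideanSpace ℝ (Fin n) → ℝ) (L : ℝ)
    (x₁ : EuclideanSpace ℝ (Fin n)) : ℝ :=
  √(2 * (f x₁ - ⨅ x, f x) / L)

/-- The constant stepsizes
`γ_k = (n+4)^{-1/2} min {1 / (4 L √(n+4)), D / (σ √N)}`, where `D / (σ √N)` is read as `+∞`
if `σ = 0`. -/
noncomputable def stepsize (n : ℕ) (L σ D : ℝ) (N : ℕ) : ℕ → ℝ := fun _ =>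
  1 / √((n : ℝ) + 4) *
    if σ = 0 then 1 / (4 * L * √((n : ℝ) + 4))
    else min (1 / (4 * L * √((n : ℝ) + 4))) (D / (σ * √(N : ℝ)))

/-- `P_R(k) = (γ_k - 2L(n+4)γ_k²) / ∑_{j=1}^N (γ_j - 2L(n+4)γ_j²)`. -/
noncomputable def probR (n : ℕ) (L : ℝ) (γ : ℕ → ℝ) (N k : ℕ) : ℝ :=
  (γ k - 2 * L * ((n : ℝ) + 4) * γ k ^ 2) /
    ∑ j ∈ Finset.Icc 1 N, (γ j - 2 * L * ((n : ℝ) + 4) * γ j ^ 2)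

/-- `B_N = 12 (n+4) L D_f² / N + (4 σ √(n+4) / √N) (D + D_f² / D)`. -/
noncomputable def Bbar (n : ℕ) (L σ D Df : ℝ) (N : ℕ) : ℝ :=
  12 * ((n : ℝ) + 4) * L * Df ^ 2 / N +
    4 * σ * √((n : ℝ) + 4) / √(N : ℝ) * (D + Df ^ 2 / D)

/-- `S(Λ) = ⌈log₂ (2 / Λ)⌉`. -/
noncomputable def numRuns (Λ : ℝ) : ℕ := ⌈Real.logb 2 (2 / Λ)⌉₊

/-- The iteration limit for accuracy `ε`. -/
noncomputable def Nhat (n : ℕ) (L σ D Df ε : ℝ) : ℕ :=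
  ⌈max (12 * ((n : ℝ) + 4) * (6 * L * Df) ^ 2 / ε)
    ((72 * L * √((n : ℝ) + 4) * (D + Df ^ 2 / D) * (σ / ε)) ^ 2)⌉₊

/-- The sample size for accuracy `ε` and confidence level `Λ`. -/
noncomputable def That (n : ℕ) (σ ε Λ : ℝ) : ℕ :=
  ⌈24 * ((n : ℝ) + 4) * ((numRuns Λ : ℝ) + 1) / Λ * max 1 (6 * σ ^ 2 / ε)⌉₊

/-! ### The sampling model -/

namespace Draws

variable {n : ℕ} {Ξ Ω : Type*}

/-- All samples and iteration counts of the runs numbered `0, …, s - 1`. -/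
def runsBefore (d : Draws n Ξ Ω) (N s : ℕ) (ω : Ω) :
    Fin s → (Fin N → Ξ × EuclideanSpace ℝ (Fin n)) × ℕ :=
  fun q => (fun j => (d.ξ q j ω, d.u q j ω), d.R q ω)

/-- What is known before iteration `k + 1` of run `s`: all earlier runs, and the first `k` samples
of this run. -/
def optHistory (d : Draws n Ξ Ω) (N s k : ℕ) (ω : Ω) :
    (Fin s → (Fin N → Ξ × EuclideanSpace ℝ (Fin n)) × ℕ) ×
      (Fin k → Ξ × EuclideanSpace ℝ (Fin n)) :=
  (d.runsBefore N s ω, fun j => (d.ξ s j ω, d.u s j ω))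

/-- What is known before sample `k + 1` of the estimate at candidate `s`: the optimization phase,
and the first `k` samples of this estimate. -/
def postHistory (d : Draws n Ξ Ω) (S N s k : ℕ) (ω : Ω) :
    (Fin S → (Fin N → Ξ × EuclideanSpace ℝ (Fin n)) × ℕ) ×
      (Fin k → Ξ × EuclideanSpace ℝ (Fin n)) :=
  (d.runsBefore N S ω, fun j => (d.ξ' s j ω, d.u' s j ω))

/-- The joint law of the random inputs of the 2-RSGF method. The noise `ξ` need not be independent
of the past: the oracle assumptions are imposed on its conditional law given the history. They
hold in particular if the `ξ`'s are independent of each other and of everything else with a common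
law that satisfies `OracleLaw`. In the post-optimization phase nothing is assumed on the joint law
of the samples for different candidates, so that the same samples may serve all of them. -/
structure IsSampling [MeasurableSpace Ξ] [StandardBorelSpace Ξ] [Nonempty Ξ] [MeasurableSpace Ω]
    (d : Draws n Ξ Ω) (Pr : Measure Ω) [IsFiniteMeasure Pr]
    (F : EuclideanSpace ℝ (Fin n) → Ξ → ℝ) (f : EuclideanSpace ℝ (Fin n) → ℝ)
    (L σ : ℝ) (γ : ℕ → ℝ) (S N T : ℕ) : Prop where
  measurable_ξ : ∀ s k, Measurable (d.ξ s k)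
  measurable_u : ∀ s k, Measurable (d.u s k)
  measurable_R : ∀ s, Measurable (d.R s)
  measurable_ξ' : ∀ s k, Measurable (d.ξ' s k)
  measurable_u' : ∀ s k, Measurable (d.u' s k)
  /-- The oracle assumptions, conditionally on the history. -/
  oracle : ∀ s < S, ∀ k < N, ∀ᵐ h ∂(Pr.map (d.optHistory N s k)),
    OracleLaw F f L σ (condDistrib (d.ξ s k) (d.optHistory N s k) Pr h)
  oracle' : ∀ s < S, ∀ k < T, ∀ᵐ h ∂(Pr.map (d.postHistory S N s k)),
    OracleLaw F f L σ (condDistrib (d.ξ' s k) (d.postHistory S N s k) Pr h)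
  /-- The directions are standard Gaussian, independent of the history and of the noise. -/
  gaussian : ∀ s < S, ∀ k < N, Pr.map (d.u s k) = stdGaussian (EuclideanSpace ℝ (Fin n))
  gaussian_indep : ∀ s < S, ∀ k < N,
    IndepFun (d.u s k) (fun ω => (d.optHistory N s k ω, d.ξ s k ω)) Pr
  gaussian' : ∀ s < S, ∀ k < T, Pr.map (d.u' s k) = stdGaussian (EuclideanSpace ℝ (Fin n))
  gaussian_indep' : ∀ s < S, ∀ k < T,
    IndepFun (d.u' s k) (fun ω => (d.postHistory S N s k ω, d.ξ' s k ω)) Pr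
  /-- The iteration counts have mass function `P_R` on `{1, …, N}` and are independent of the
  earlier runs and of the samples of their run. -/
  R_mem : ∀ s < S, ∀ ω, d.R s ω ∈ Finset.Icc 1 N
  R_law : ∀ s < S, ∀ k ∈ Finset.Icc 1 N, Pr.real {ω | d.R s ω = k} = probR n L γ N k
  R_indep : ∀ s < S, IndepFun (d.R s) (d.optHistory N s N) Pr

end Draws

/-- A random point `X` is an `(ε, Λ)`-solution: `P{‖∇f(X)‖² ≤ ε} ≥ 1 - Λ`. -/
def IsEpsLamSolution {n : ℕ} {Ω : Type*} [MeasurableSpace Ω] (Pr : Measure Ω)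
    (f : EuclideanSpace ℝ (Fin n) → ℝ) (ε Λ : ℝ) (X : Ω → EuclideanSpace ℝ (Fin n)) : Prop :=
  1 - Λ ≤ Pr.real {ω | ‖gradient f (X ω)‖ ^ 2 ≤ ε}

/-! ### Moments of standard Gaussian vectors -/

/-! A Taylor estimate writes `G_μ` as `⟨∇F, u⟩ u` plus an error of norm at most `μL‖u‖³/2`. Since
`E[⟨a, u⟩ u] = a`, its mean `meanQuot f μ x` is within `biasBound` of `∇f(x)`, and its second moment
is at most `momentBound`. No smoothed surrogate of `f` is needed. The noise may depend on the past,
but unbiasedness of the oracle makes the conditional mean a function of `f`, `μ` and `x` alone.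

Optimization phase: the quadratic upper bound on `f` along a step makes the expected decrease at
least `(γ - 2L(n+4)γ²)/2 · ‖∇f‖²` up to a small error. Telescoping over the iterations and averaging
over `R` gives `E‖∇f(x_R)‖² ≤ L · Bbar`. This is proved with an arbitrary nonnegative weight
depending on the earlier runs, so it is a conditional statement. Markov's inequality at twice the
mean and induction over the runs (`measure_forall_candidate_le`) then bound by `2^{-S}` the
probability that every candidate is bad, without independent runs.

Post-optimization phase: the estimates centred at `meanQuot` are martingale differences, so their
second moments add up, and Markov's inequality controls each candidate
(`measure_estimate_error_le`). A union bound tolerates samples shared between candidates. If all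
estimates are within `e` of the gradient and candidate `s` is good, then `‖∇f(x*)‖ ≤ ‖g(x*)‖ + e ≤
‖g(x_s)‖ + e ≤ ‖∇f(x_s)‖ + 2e`. `measureReal_output_le` records this with a free error threshold
`c`; (a) and (b) choose `c` differently. Along the runs only nonnegative quantities are integrated,
as `ENNReal`-valued integrals, so integrability of the iterates never arises. -/

lemma iteratedDeriv_exp_sq_half (k : ℕ) :
    iteratedDeriv k (fun t : ℝ => Real.exp (t ^ 2 / 2)) = fun t =>
      ((fun q : Polynomial ℝ => q.derivative + Polynomial.X * q)^[k] 1).eval t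
        * Real.exp (t ^ 2 / 2) := by
  induction k with
  | zero => ext t; simp
  | succ k ih =>
    rw [iteratedDeriv_succ, ih]
    ext t
    rw [Function.iterate_succ_apply']
    set q := (fun q : Polynomial ℝ => q.derivative + Polynomial.X * q)^[k] 1
    have h1 : HasDerivAt (fun t : ℝ => Real.exp (t ^ 2 / 2)) (Real.exp (t ^ 2 / 2) * t) t := by
      have h2 : HasDerivAt (fun t : ℝ => t ^ 2 / 2) t t := by
        simpa using ((hasDerivAt_id t).pow 2).div_const 2
      exact h2.exp
    have h2 : HasDerivAt (fun t => q.eval t * Real.exp (t ^ 2 / 2)) _ t :=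
      (q.hasDerivAt t).mul h1
    rw [h2.deriv]
    simp only [Polynomial.eval_add, Polynomial.eval_mul, Polynomial.eval_X]
    ring

/-- The moments are derivatives at `0` of the moment generating function `exp(t²/2)`. Each
derivative is a polynomial `q` times this exponential, and differentiating once more turns `q` into
`q' + Xq`. -/
lemma integral_pow_gaussianReal_zero_one (k : ℕ) :
    ∫ x, x ^ k ∂(gaussianReal 0 1) =
      ((fun q : Polynomial ℝ => q.derivative + Polynomial.X * q)^[k] 1).eval 0 := by
  have h := iteratedDeriv_mgf_zero (X := id) (μ := gaussianReal 0 1) (by simp) k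
  have h2 : mgf id (gaussianReal 0 1) = fun t : ℝ => Real.exp (t ^ 2 / 2) := by
    rw [mgf_id_gaussianReal]; simp
  rw [h2, iteratedDeriv_exp_sq_half] at h
  simpa using h.symm

lemma integral_sq_gaussianReal_zero_one : ∫ x, x ^ 2 ∂(gaussianReal 0 1) = 1 := by
  rw [integral_pow_gaussianReal_zero_one]
  simp [Function.iterate_succ_apply']

lemma integral_pow_four_gaussianReal_zero_one : ∫ x, x ^ 4 ∂(gaussianReal 0 1) = 3 := by
  rw [integral_pow_gaussianReal_zero_one]
  simp [Function.iterate_succ_apply', Polynomial.derivative_mul]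
  norm_num

lemma integral_pow_six_gaussianReal_zero_one : ∫ x, x ^ 6 ∂(gaussianReal 0 1) = 15 := by
  rw [integral_pow_gaussianReal_zero_one]
  simp [Function.iterate_succ_apply', Polynomial.derivative_mul]
  norm_num

section StdGaussian

variable {n : ℕ}

local notation "𝔼" n => EuclideanSpace ℝ (Fin n)

lemma integrable_norm_pow_stdGaussian (k : ℕ) :
    Integrable (fun u : 𝔼 n => ‖u‖ ^ k) (stdGaussian (𝔼 n)) := by
  have := (IsGaussian.memLp_id (stdGaussian (𝔼 n)) k (by simp)).integrable_norm_pow'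
  simpa using this

/-- The coordinates of a standard Gaussian vector in an orthonormal basis are independent
standard Gaussian. -/
lemma integral_stdGaussian_eq_pi {ι : Type*} [Fintype ι]
    (b : OrthonormalBasis ι ℝ (𝔼 n)) {φ : (ι → ℝ) → ℝ} (hφ : Continuous φ) :
    ∫ u, φ (fun i => inner ℝ (b i) u) ∂(stdGaussian (𝔼 n)) =
      ∫ z, φ z ∂(Measure.pi fun _ : ι => gaussianReal 0 1) := by
  rw [stdGaussian_eq_map_pi_orthonormalBasis b, integral_map
    (Continuous.aemeasurable (by fun_prop)) (by apply Continuous.aestronglyMeasurable; fun_prop)]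
  classical
  congr with z
  congr with i
  simp [inner_sum, real_inner_smul_right, b.inner_eq_ite]

lemma integral_inner_pow_stdGaussian {ι : Type*} [Fintype ι]
    (b : OrthonormalBasis ι ℝ (𝔼 n)) (i : ι) (k : ℕ) :
    ∫ u, inner ℝ (b i) u ^ k ∂(stdGaussian (𝔼 n)) = ∫ x, x ^ k ∂(gaussianReal 0 1) := by
  rw [integral_stdGaussian_eq_pi b (φ := fun z => z i ^ k) (by fun_prop)]
  have h := (measurePreserving_eval (fun _ : ι => gaussianReal 0 1) i)
  conv_rhs => rw [← h.map_eq]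
  rw [integral_map h.measurable.aemeasurable (by fun_prop)]

lemma integral_inner_sq_mul_inner_sq_stdGaussian {ι : Type*} [Fintype ι]
    (b : OrthonormalBasis ι ℝ (𝔼 n)) {i j : ι} (hij : i ≠ j) :
    ∫ u, inner ℝ (b i) u ^ 2 * inner ℝ (b j) u ^ 2 ∂(stdGaussian (𝔼 n)) = 1 := by
  rw [integral_stdGaussian_eq_pi b (φ := fun z => z i ^ 2 * z j ^ 2) (by fun_prop)]
  have h := (iIndepFun_pi (μ := fun _ : ι => gaussianReal 0 1)
    (X := fun _ x => x ^ 2) (fun i => by fun_prop)).indepFun hij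
  have h2 := h.integral_fun_mul_eq_mul_integral
    (Continuous.aestronglyMeasurable (by fun_prop))
    (Continuous.aestronglyMeasurable (by fun_prop))
  rw [h2]
  have e : ∀ i : ι, ∫ z : ι → ℝ, z i ^ 2 ∂(Measure.pi fun _ : ι => gaussianReal 0 1) = 1 := by
    intro i
    rw [← integral_stdGaussian_eq_pi b (φ := fun z => z i ^ 2) (by fun_prop),
      integral_inner_pow_stdGaussian, integral_sq_gaussianReal_zero_one]
  rw [e, e, one_mul]

lemma integrable_stdGaussian_of_norm_le_pow {F : Type*} [NormedAddCommGroup F]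
    {φ : (𝔼 n) → F} (hφ : AEStronglyMeasurable φ (stdGaussian (𝔼 n))) (C : ℝ) (k : ℕ)
    (h : ∀ u, ‖φ u‖ ≤ C * ‖u‖ ^ k) :
    Integrable φ (stdGaussian (𝔼 n)) :=
  ((integrable_norm_pow_stdGaussian k).const_mul C).mono' hφ (.of_forall h)

/-- In an orthonormal basis containing `g/‖g‖`, expanding `‖u‖²` leaves one fourth moment `3` and `n
- 1` products of second moments `1`. -/
lemma integral_inner_sq_mul_norm_sq_stdGaussian (g : 𝔼 n) :
    ∫ u, inner ℝ g u ^ 2 * ‖u‖ ^ 2 ∂(stdGaussian (𝔼 n)) = (n + 2) * ‖g‖ ^ 2 := by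
  rcases eq_or_ne g 0 with rfl | hg
  · simp
  have hn : n ≠ 0 := by
    rintro rfl; exact hg (Subsingleton.elim _ _)
  let i0 : Fin n := ⟨0, Nat.pos_of_ne_zero hn⟩
  have hg' : ‖g‖ ≠ 0 := norm_ne_zero_iff.2 hg
  obtain ⟨b, hb⟩ := Orthonormal.exists_orthonormalBasis_extension_of_card_eq (𝕜 := ℝ)
    (E := 𝔼 n) (ι := Fin n) (by simp) (v := fun _ => ‖g‖⁻¹ • g) (s := {i0}) (by
      constructor
      · intro i; simp [norm_smul, hg']
      · intro i j hij
        exact absurd (Subsingleton.elim i j) hij)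
  have hgb : g = ‖g‖ • b i0 := by
    rw [hb i0 rfl, smul_smul, mul_inv_cancel₀ hg', one_smul]
  have e : ∀ u : 𝔼 n, inner ℝ g u ^ 2 * ‖u‖ ^ 2 =
      ‖g‖ ^ 2 * ∑ j, inner ℝ (b i0) u ^ 2 * inner ℝ (b j) u ^ 2 := by
    intro u
    conv_lhs => rw [hgb, real_inner_smul_left, ← b.sum_sq_inner_right u]
    rw [← Finset.mul_sum]; ring
  simp_rw [e]
  rw [integral_const_mul, integral_finsetSum]
  · have e2 : ∀ j, ∫ u, inner ℝ (b i0) u ^ 2 * inner ℝ (b j) u ^ 2 ∂(stdGaussian (𝔼 n)) =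
        if j = i0 then 3 else 1 := by
      intro j
      split_ifs with h
      · rw [h]
        simp_rw [← pow_add]
        rw [integral_inner_pow_stdGaussian, integral_pow_four_gaussianReal_zero_one]
      · exact integral_inner_sq_mul_inner_sq_stdGaussian b (Ne.symm h)
    simp_rw [e2]
    have e3 : ∀ j : Fin n, (if j = i0 then (3 : ℝ) else 1) = 1 + if j = i0 then 2 else 0 := by
      intro j; split_ifs <;> norm_num
    simp_rw [e3, Finset.sum_add_distrib]
    simp
    ring
  · intro j _
    refine integrable_stdGaussian_of_norm_le_pow
      (by apply Continuous.aestronglyMeasurable; fun_prop) 1 4 fun u => ?_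
    have h1 := abs_real_inner_le_norm (b i0) u
    have h2 := abs_real_inner_le_norm (b j) u
    rw [b.norm_eq_one, one_mul] at h1 h2
    rw [norm_mul, norm_pow, norm_pow, Real.norm_eq_abs, Real.norm_eq_abs]
    calc _ ≤ ‖u‖ ^ 2 * ‖u‖ ^ 2 := by gcongr
      _ = _ := by ring

lemma integral_norm_sq_stdGaussian : ∫ u, ‖u‖ ^ 2 ∂(stdGaussian (𝔼 n)) = n := by
  let b := EuclideanSpace.basisFun (Fin n) ℝ
  have e : ∀ u : 𝔼 n, ‖u‖ ^ 2 = ∑ j, inner ℝ (b j) u ^ 2 := fun u =>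
    (b.sum_sq_inner_right u).symm
  simp_rw [e]
  rw [integral_finsetSum]
  · simp_rw [integral_inner_pow_stdGaussian, integral_sq_gaussianReal_zero_one]
    simp
  · intro j _
    refine integrable_stdGaussian_of_norm_le_pow
      (by apply Continuous.aestronglyMeasurable; fun_prop) 1 2 fun u => ?_
    have h2 := abs_real_inner_le_norm (b j) u
    rw [b.norm_eq_one, one_mul] at h2
    rw [norm_pow, one_mul, Real.norm_eq_abs]
    gcongr

lemma integral_norm_pow_four_stdGaussian :
    ∫ u, ‖u‖ ^ 4 ∂(stdGaussian (𝔼 n)) = n * (n + 2) := by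
  let b := EuclideanSpace.basisFun (Fin n) ℝ
  have e : ∀ u : 𝔼 n, ‖u‖ ^ 4 = ∑ j, inner ℝ (b j) u ^ 2 * ‖u‖ ^ 2 := fun u => by
    rw [← Finset.sum_mul, b.sum_sq_inner_right u]; ring
  simp_rw [e]
  rw [integral_finsetSum]
  · simp_rw [integral_inner_sq_mul_norm_sq_stdGaussian, b.norm_eq_one]
    simp [mul_add]
  · intro j _
    refine integrable_stdGaussian_of_norm_le_pow
      (by apply Continuous.aestronglyMeasurable; fun_prop) 1 4 fun u => ?_
    have h2 := abs_real_inner_le_norm (b j) u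
    rw [b.norm_eq_one, one_mul] at h2
    rw [norm_mul, norm_pow, norm_pow, Real.norm_eq_abs, norm_norm]
    calc _ ≤ ‖u‖ ^ 2 * ‖u‖ ^ 2 := by gcongr
      _ = _ := by ring

/-- Power mean inequality `(∑ a_j)³ ≤ n² ∑ a_j³` for the squared coordinates; the crude constant
`15` is good enough later. -/
lemma integral_norm_pow_six_stdGaussian_le :
    ∫ u, ‖u‖ ^ 6 ∂(stdGaussian (𝔼 n)) ≤ 15 * n ^ 3 := by
  let b := EuclideanSpace.basisFun (Fin n) ℝ
  have hint : ∀ j, Integrable (fun u => inner ℝ (b j) u ^ 6) (stdGaussian (𝔼 n)) := by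
    intro j
    refine integrable_stdGaussian_of_norm_le_pow
      (by apply Continuous.aestronglyMeasurable; fun_prop) 1 6 fun u => ?_
    have h2 := abs_real_inner_le_norm (b j) u
    rw [b.norm_eq_one, one_mul] at h2
    rw [norm_pow, one_mul, Real.norm_eq_abs]
    gcongr
  have e : ∀ u : 𝔼 n, ‖u‖ ^ 6 ≤ n ^ 2 * ∑ j, inner ℝ (b j) u ^ 6 := fun u => by
    have h3 := pow_sum_le_card_mul_sum_pow (s := Finset.univ)
      (f := fun j => inner ℝ (b j) u ^ 2) (fun j _ => by positivity) 2
    rw [b.sum_sq_inner_right u] at h3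
    simp only [Finset.card_univ, Fintype.card_fin, ← pow_mul] at h3
    exact h3
  calc ∫ u, ‖u‖ ^ 6 ∂(stdGaussian (𝔼 n))
      ≤ ∫ u, n ^ 2 * ∑ j, inner ℝ (b j) u ^ 6 ∂(stdGaussian (𝔼 n)) :=
        integral_mono (integrable_norm_pow_stdGaussian 6)
          ((integrable_finsetSum _ fun j _ => hint j).const_mul _) e
    _ = 15 * n ^ 3 := by
        rw [integral_const_mul, integral_finsetSum _ fun j _ => hint j]
        simp_rw [integral_inner_pow_stdGaussian, integral_pow_six_gaussianReal_zero_one]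
        simp
        ring

lemma integral_norm_pow_three_stdGaussian_le :
    ∫ u, ‖u‖ ^ 3 ∂(stdGaussian (𝔼 n)) ≤ n * √(n + 2) := by
  -- With this weight the two terms of the bound on `‖u‖³` below have equal integrals.
  set t : ℝ := √(n + 2)
  have ht : 0 < t := by positivity
  have ht2 : t ^ 2 = n + 2 := Real.sq_sqrt (by positivity)
  have e : ∀ u : 𝔼 n, ‖u‖ ^ 3 ≤ t / 2 * ‖u‖ ^ 2 + 1 / (2 * t) * ‖u‖ ^ 4 := fun u => by
    have : t / 2 * ‖u‖ ^ 2 + 1 / (2 * t) * ‖u‖ ^ 4 - ‖u‖ ^ 3 =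
        ‖u‖ ^ 2 * (t - ‖u‖) ^ 2 / (2 * t) := by field_simp; ring
    have h2 : 0 ≤ ‖u‖ ^ 2 * (t - ‖u‖) ^ 2 / (2 * t) := by positivity
    linarith
  calc ∫ u, ‖u‖ ^ 3 ∂(stdGaussian (𝔼 n))
      ≤ ∫ u, (t / 2 * ‖u‖ ^ 2 + 1 / (2 * t) * ‖u‖ ^ 4) ∂(stdGaussian (𝔼 n)) :=
        integral_mono (integrable_norm_pow_stdGaussian 3)
          (((integrable_norm_pow_stdGaussian 2).const_mul _).add
            ((integrable_norm_pow_stdGaussian 4).const_mul _)) e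
    _ = n * t := by
        rw [integral_add ((integrable_norm_pow_stdGaussian 2).const_mul _)
          ((integrable_norm_pow_stdGaussian 4).const_mul _), integral_const_mul,
          integral_const_mul, integral_norm_sq_stdGaussian, integral_norm_pow_four_stdGaussian,
          ← ht2]
        field_simp
        ring

lemma integrable_inner_smul_stdGaussian (g : 𝔼 n) :
    Integrable (fun u : 𝔼 n => (inner ℝ g u : ℝ) • u) (stdGaussian (𝔼 n)) := by
  refine integrable_stdGaussian_of_norm_le_pow
    (by apply Continuous.aestronglyMeasurable; fun_prop) ‖g‖ 2 fun u => ?_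
  rw [norm_smul, pow_two, ← mul_assoc]
  gcongr
  exact norm_inner_le_norm g u

lemma integral_inner_smul_stdGaussian (g : 𝔼 n) :
    ∫ u, (inner ℝ g u : ℝ) • u ∂(stdGaussian (𝔼 n)) = g := by
  have hint := integrable_inner_smul_stdGaussian g
  refine ext_inner_left ℝ fun w => ?_
  rw [← integral_inner hint w]
  have h := covarianceBilin_apply (μ := stdGaussian (𝔼 n)) IsGaussian.memLp_two_id w g
  rw [covarianceBilin_stdGaussian] at h
  simp only [id, integral_id_stdGaussian, sub_zero] at h
  refine Eq.trans ?_ h.symm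
  congr with u
  rw [real_inner_smul_right, mul_comm]

end StdGaussian

/-! ### Functions with Lipschitz gradient -/

section Smooth

variable {n : ℕ}

local notation "𝔼" n => EuclideanSpace ℝ (Fin n)

lemma hasDerivAt_comp_add_smul {g : (𝔼 n) → ℝ} (hg : Differentiable ℝ g) (x v : 𝔼 n) (t : ℝ) :
    HasDerivAt (fun s : ℝ => g (x + s • v)) (inner ℝ (gradient g (x + t • v)) v) t := by
  have h1 : HasDerivAt (fun s : ℝ => x + s • v) v t := by
    simpa using ((hasDerivAt_id t).smul_const v).const_add x
  have h2 := (hg (x + t • v)).hasGradientAt.hasFDerivAt.comp_hasDerivAt t h1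
  have e : inner ℝ (gradient g (x + t • v)) v
      = InnerProductSpace.toDual ℝ (𝔼 n) (gradient g (x + t • v)) v := by simp
  rw [e]
  exact h2

/-- Along the segment the remainder has derivative at most `L t ‖v‖²`, which is the derivative of
`L/2 ‖v‖² t²`. -/
lemma IsC11.abs_sub_inner_le {L : ℝ} {g : (𝔼 n) → ℝ} (hg : IsC11 L g) (x v : 𝔼 n) :
    |g (x + v) - g x - inner ℝ (gradient g x) v| ≤ L / 2 * ‖v‖ ^ 2 := by
  have hd : ∀ t : ℝ, HasDerivAt
      (fun s : ℝ => g (x + s • v) - g x - s * inner ℝ (gradient g x) v)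
      (inner ℝ (gradient g (x + t • v)) v - inner ℝ (gradient g x) v) t := fun t => by
    have h := ((hasDerivAt_comp_add_smul hg.1 x v t).sub_const (g x)).sub
      ((hasDerivAt_id t).mul_const (inner ℝ (gradient g x) v))
    rw [one_mul] at h
    exact h
  have hB : ∀ t : ℝ, HasDerivAt (fun s : ℝ => L / 2 * ‖v‖ ^ 2 * s ^ 2) (L * ‖v‖ ^ 2 * t) t :=
    fun t => by
      have := ((hasDerivAt_id t).pow 2).const_mul (L / 2 * ‖v‖ ^ 2)
      refine this.congr_deriv ?_
      simp; ring
  have := image_norm_le_of_norm_deriv_right_le_deriv_boundary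
    (f := fun s : ℝ => g (x + s • v) - g x - s * inner ℝ (gradient g x) v) (a := 0) (b := 1)
    (fun t _ => (hd t).continuousAt.continuousWithinAt)
    (fun t _ => (hd t).hasDerivWithinAt)
    (B := fun s : ℝ => L / 2 * ‖v‖ ^ 2 * s ^ 2) (by simp) hB
    (fun t ht => by
      rw [← inner_sub_left]
      refine (norm_inner_le_norm _ _).trans ?_
      have h := hg.2 x (x + t • v)
      rw [add_sub_cancel_left, norm_smul, Real.norm_of_nonneg ht.1] at h
      calc _ ≤ L * (t * ‖v‖) * ‖v‖ := by gcongr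
        _ = _ := by ring)
    (x := 1) (by simp)
  simpa using this

lemma IsC11.le_add {L : ℝ} {g : (𝔼 n) → ℝ} (hg : IsC11 L g) (x v : 𝔼 n) :
    g (x + v) ≤ g x + inner ℝ (gradient g x) v + L / 2 * ‖v‖ ^ 2 := by
  have := (abs_le.1 (hg.abs_sub_inner_le x v)).2
  linarith

lemma IsC11.continuous_gradient {L : ℝ} (hL : 0 ≤ L) {g : (𝔼 n) → ℝ} (hg : IsC11 L g) :
    Continuous (gradient g) := by
  have : LipschitzWith ⟨L, hL⟩ (gradient g) :=
    LipschitzWith.of_dist_le_mul fun x y => by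
      rw [dist_eq_norm, dist_eq_norm]; exact hg.2 y x
  exact this.continuous

variable {Ξ : Type*} [MeasurableSpace Ξ]

/-- Directional derivatives are almost everywhere limits of measurable difference quotients, and
they are bounded by the unit increment of `F` plus `L/2 ‖v‖²`. Coordinates then give the gradient.
-/
lemma integrable_gradient_of_isC11 {F : (𝔼 n) → Ξ → ℝ} {P : Measure Ξ} [IsFiniteMeasure P]
    (hFint : ∀ x, Integrable (F x) P) {L : ℝ}
    (hFsmooth : ∀ᵐ ξ ∂P, IsC11 L (fun x => F x ξ)) (x : 𝔼 n) :
    Integrable (fun ξ => gradient (fun y => F y ξ) x) P := by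
  have hv : ∀ v, Integrable (fun ξ => (inner ℝ (gradient (fun y => F y ξ) x) v : ℝ)) P := by
    intro v
    have hm : AEStronglyMeasurable
        (fun ξ => (inner ℝ (gradient (fun y => F y ξ) x) v : ℝ)) P := by
      refine aestronglyMeasurable_of_tendsto_ae (nhdsWithin (0 : ℝ) {0}ᶜ)
        (f := fun (t : ℝ) ξ => t⁻¹ • (F (x + t • v) ξ - F x ξ)) (fun t => ?_) ?_
      · exact (((hFint _).sub (hFint _)).smul t⁻¹).aestronglyMeasurable
      · filter_upwards [hFsmooth] with ξ hξ
        have := (hasDerivAt_comp_add_smul hξ.1 x v 0).tendsto_slope_zero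
        simpa using this
    refine (((hFint (x + v)).sub (hFint x)).norm.add (integrable_const (L / 2 * ‖v‖ ^ 2))).mono'
      hm ?_
    filter_upwards [hFsmooth] with ξ hξ
    have h := hξ.abs_sub_inner_le x v
    simp only [Pi.add_apply, Pi.sub_apply, Real.norm_eq_abs]
    rw [abs_sub_comm] at h
    have := abs_sub_abs_le_abs_sub (inner ℝ (gradient (fun y => F y ξ) x) v : ℝ)
      (F (x + v) ξ - F x ξ)
    linarith
  let b := EuclideanSpace.basisFun (Fin n) ℝ
  have e : (fun ξ => gradient (fun y => F y ξ) x) =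
      fun ξ => ∑ i, (inner ℝ (gradient (fun y => F y ξ) x) (b i) : ℝ) • b i := by
    ext1 ξ
    conv_lhs => rw [← b.sum_repr' (gradient (fun y => F y ξ) x)]
    simp_rw [real_inner_comm]
  rw [e]
  exact integrable_finsetSum _ fun i _ => (hv (b i)).smul_const _

/-- The quadratic bound on the remainder survives integration over the noise, and a quadratic
remainder is little-o of the increment. -/
lemma hasGradientAt_objective {F : (𝔼 n) → Ξ → ℝ} {P : Measure Ξ} [IsProbabilityMeasure P]
    (hFint : ∀ x, Integrable (F x) P) {L : ℝ}
    (hFsmooth : ∀ᵐ ξ ∂P, IsC11 L (fun x => F x ξ)) (x : 𝔼 n) :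
    HasGradientAt (objective F P) (∫ ξ, gradient (fun y => F y ξ) x ∂P) x := by
  have hG := integrable_gradient_of_isC11 hFint hFsmooth x
  have hb : ∀ y, ‖objective F P y - objective F P x
      - inner ℝ (∫ ξ, gradient (fun y => F y ξ) x ∂P) (y - x)‖ ≤ L / 2 * ‖y - x‖ ^ 2 := by
    intro y
    have e : objective F P y - objective F P x
        - inner ℝ (∫ ξ, gradient (fun y => F y ξ) x ∂P) (y - x) =
        ∫ ξ, (F y ξ - F x ξ - inner ℝ (gradient (fun y => F y ξ) x) (y - x)) ∂P := by
      have h1 : Integrable (fun ξ => F y ξ - F x ξ) P := (hFint y).sub (hFint x)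
      rw [integral_sub h1 (hG.inner_const _),
        integral_sub (hFint y) (hFint x)]
      congr 1
      rw [real_inner_comm, ← integral_inner hG]
      simp_rw [real_inner_comm]
    rw [e]
    refine (norm_integral_le_of_norm_le_const (C := L / 2 * ‖y - x‖ ^ 2) ?_).trans (by simp)
    filter_upwards [hFsmooth] with ξ hξ
    simpa using hξ.abs_sub_inner_le x (y - x)
  rw [hasGradientAt_iff_isLittleO]
  refine (Asymptotics.IsBigO.of_bound (L / 2) (.of_forall fun y => ?_) :
    _ =O[nhds x] fun y => ‖y - x‖ ^ 2).trans_isLittleO ?_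
  · rw [norm_pow, norm_norm]
    exact hb y
  · have := (Asymptotics.isLittleO_norm_pow_id (E' := 𝔼 n) one_lt_two).comp_tendsto
      (show Filter.Tendsto (fun y => y - x) (nhds x) (nhds 0) from
        Continuous.tendsto' (by fun_prop) x 0 (by simp))
    exact this

lemma isC11_objective {F : (𝔼 n) → Ξ → ℝ} {P : Measure Ξ} [IsProbabilityMeasure P]
    (hFint : ∀ x, Integrable (F x) P) {L : ℝ}
    (hFsmooth : ∀ᵐ ξ ∂P, IsC11 L (fun x => F x ξ)) :
    IsC11 L (objective F P) := by
  refine ⟨fun x => (hasGradientAt_objective hFint hFsmooth x).differentiableAt, fun x y => ?_⟩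
  rw [(hasGradientAt_objective hFint hFsmooth x).gradient,
    (hasGradientAt_objective hFint hFsmooth y).gradient,
    ← integral_sub (integrable_gradient_of_isC11 hFint hFsmooth y)
      (integrable_gradient_of_isC11 hFint hFsmooth x)]
  refine (norm_integral_le_of_norm_le_const (C := L * ‖y - x‖) ?_).trans (by simp)
  filter_upwards [hFsmooth] with ξ hξ using hξ.2 x y

end Smooth

/-! ### The Gaussian gradient estimator at a fixed point -/

section Estimator

variable {n : ℕ}

local notation "𝔼" n => EuclideanSpace ℝ (Fin n)

/-- The forward difference quotient `((g(x + μ u) - g(x)) / μ) u`. -/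
noncomputable def diffQuot (g : (𝔼 n) → ℝ) (μ : ℝ) (x u : 𝔼 n) : 𝔼 n :=
  ((g (x + μ • u) - g x) / μ) • u

/-- The mean of `diffQuot` over a standard Gaussian direction. -/
noncomputable def meanQuot (g : (𝔼 n) → ℝ) (μ : ℝ) (x : 𝔼 n) : 𝔼 n :=
  ∫ u, diffQuot g μ x u ∂(stdGaussian (𝔼 n))

/-- A bound on the second moment of the stochastic gradient estimator. -/
noncomputable def momentBound (f : (𝔼 n) → ℝ) (L σ μ : ℝ) (x : 𝔼 n) : ℝ :=
  2 * (n + 2) * (‖gradient f x‖ ^ 2 + σ ^ 2) + 15 / 2 * μ ^ 2 * L ^ 2 * n ^ 3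

/-- A bound on the bias of the gradient estimator. -/
noncomputable def biasBound (n : ℕ) (L μ : ℝ) : ℝ := μ * L / 2 * (n * √(n + 2))

lemma biasBound_sq (n : ℕ) (L μ : ℝ) :
    biasBound n L μ ^ 2 = μ ^ 2 * L ^ 2 / 4 * (n ^ 2 * (n + 2)) := by
  rw [biasBound, mul_pow, mul_pow _ √_, Real.sq_sqrt (by positivity)]
  ring

variable {L μ : ℝ} {g f : (𝔼 n) → ℝ}

lemma IsC11.norm_diffQuot_sub_le (hμ : 0 < μ) (hg : IsC11 L g) (x u : 𝔼 n) :
    ‖diffQuot g μ x u - (inner ℝ (gradient g x) u : ℝ) • u‖ ≤ μ * L / 2 * ‖u‖ ^ 3 := by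
  have h := hg.abs_sub_inner_le x (μ • u)
  rw [real_inner_smul_right, norm_smul, Real.norm_of_nonneg hμ.le] at h
  rw [diffQuot, ← sub_smul, norm_smul]
  have e : (g (x + μ • u) - g x) / μ - inner ℝ (gradient g x) u =
      (g (x + μ • u) - g x - μ * inner ℝ (gradient g x) u) / μ := by field_simp
  rw [e, norm_div, Real.norm_of_nonneg hμ.le, Real.norm_eq_abs]
  calc _ ≤ (L / 2 * (μ * ‖u‖) ^ 2) / μ * ‖u‖ := by gcongr
    _ = _ := by field_simp

lemma IsC11.continuous_diffQuot (hg : IsC11 L g) (x : 𝔼 n) : Continuous (diffQuot g μ x) := by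
  have := hg.1.continuous
  unfold diffQuot
  fun_prop

lemma IsC11.integrable_diffQuot (hμ : 0 < μ) (hg : IsC11 L g) (x : 𝔼 n) :
    Integrable (diffQuot g μ x) (stdGaussian (𝔼 n)) := by
  have h1 : Integrable (fun u => diffQuot g μ x u - (inner ℝ (gradient g x) u : ℝ) • u)
      (stdGaussian (𝔼 n)) :=
    integrable_stdGaussian_of_norm_le_pow
      (((hg.continuous_diffQuot x).sub (by fun_prop)).aestronglyMeasurable) (μ * L / 2) 3
      fun u => hg.norm_diffQuot_sub_le hμ x u
  have h2 := integrable_inner_smul_stdGaussian (gradient g x)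
  exact (h1.add h2).congr (.of_forall fun u => sub_add_cancel _ _)

lemma IsC11.measurable_meanQuot (hg : IsC11 L g) : Measurable (meanQuot g μ) := by
  have hc := hg.1.continuous
  have h : Continuous fun p : (𝔼 n) × (𝔼 n) => diffQuot g μ p.1 p.2 := by
    unfold diffQuot
    fun_prop
  exact (h.stronglyMeasurable.integral_prod_right' (ν := stdGaussian (𝔼 n))).measurable

/-- Once the gradient is itself written as the mean of `⟨∇g, u⟩ u`, the pointwise cubic error can be
integrated. -/
lemma IsC11.norm_meanQuot_sub_le (hL : 0 < L) (hμ : 0 < μ) (hg : IsC11 L g) (x : 𝔼 n) :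
    ‖meanQuot g μ x - gradient g x‖ ≤ biasBound n L μ := by
  have h2 := integrable_inner_smul_stdGaussian (gradient g x)
  conv_lhs => rw [← integral_inner_smul_stdGaussian (gradient g x), meanQuot,
    ← integral_sub (hg.integrable_diffQuot hμ x) h2]
  calc _ ≤ ∫ u, μ * L / 2 * ‖u‖ ^ 3 ∂(stdGaussian (𝔼 n)) :=
        norm_integral_le_of_norm_le ((integrable_norm_pow_stdGaussian 3).const_mul _)
          (.of_forall fun u => hg.norm_diffQuot_sub_le hμ x u)
    _ ≤ _ := by
        rw [integral_const_mul, biasBound]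
        gcongr
        exact integral_norm_pow_three_stdGaussian_le

lemma IsC11.norm_diffQuot_sq_le (hμ : 0 < μ) (hg : IsC11 L g) (x u : 𝔼 n) :
    ‖diffQuot g μ x u‖ ^ 2 ≤ 2 * (inner ℝ (gradient g x) u ^ 2 * ‖u‖ ^ 2)
      + μ ^ 2 * L ^ 2 / 2 * ‖u‖ ^ 6 := by
  have h := hg.norm_diffQuot_sub_le hμ x u
  have h2 : ‖diffQuot g μ x u‖ ≤ ‖(inner ℝ (gradient g x) u : ℝ) • u‖ + μ * L / 2 * ‖u‖ ^ 3 := by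
    have := norm_add_le ((inner ℝ (gradient g x) u : ℝ) • u)
      (diffQuot g μ x u - (inner ℝ (gradient g x) u : ℝ) • u)
    rw [add_sub_cancel] at this
    linarith
  calc ‖diffQuot g μ x u‖ ^ 2
      ≤ (‖(inner ℝ (gradient g x) u : ℝ) • u‖ + μ * L / 2 * ‖u‖ ^ 3) ^ 2 := by gcongr
    _ ≤ 2 * (‖(inner ℝ (gradient g x) u : ℝ) • u‖ ^ 2 + (μ * L / 2 * ‖u‖ ^ 3) ^ 2) :=
        add_sq_le
    _ = _ := by
        rw [norm_smul, mul_pow, Real.norm_eq_abs, sq_abs]; ring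

lemma integrable_inner_sq_mul_norm_sq_stdGaussian (g : 𝔼 n) :
    Integrable (fun u => inner ℝ g u ^ 2 * ‖u‖ ^ 2) (stdGaussian (𝔼 n)) := by
  refine integrable_stdGaussian_of_norm_le_pow
      (by apply Continuous.aestronglyMeasurable; fun_prop) (‖g‖ ^ 2) 4 fun u => ?_
  rw [norm_mul, norm_pow, norm_pow, norm_norm]
  calc _ ≤ (‖g‖ * ‖u‖) ^ 2 * ‖u‖ ^ 2 := by gcongr; exact norm_inner_le_norm _ u
    _ = _ := by ring

lemma IsC11.integrable_norm_diffQuot_sq (hμ : 0 < μ) (hg : IsC11 L g) (x : 𝔼 n) :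
    Integrable (fun u => ‖diffQuot g μ x u‖ ^ 2) (stdGaussian (𝔼 n)) := by
  refine (((integrable_inner_sq_mul_norm_sq_stdGaussian (gradient g x)).const_mul 2).add
    ((integrable_norm_pow_stdGaussian 6).const_mul (μ ^ 2 * L ^ 2 / 2))).mono'
    ((hg.continuous_diffQuot x).norm.pow 2).aestronglyMeasurable (.of_forall fun u => ?_)
  rw [norm_pow, norm_norm]
  exact hg.norm_diffQuot_sq_le hμ x u

lemma IsC11.integral_norm_diffQuot_sq_le (hμ : 0 < μ) (hg : IsC11 L g) (x : 𝔼 n) :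
    ∫ u, ‖diffQuot g μ x u‖ ^ 2 ∂(stdGaussian (𝔼 n)) ≤
      2 * (n + 2) * ‖gradient g x‖ ^ 2 + 15 / 2 * μ ^ 2 * L ^ 2 * n ^ 3 := by
  have h1 := (integrable_inner_sq_mul_norm_sq_stdGaussian (gradient g x)).const_mul 2
  have h2 := (integrable_norm_pow_stdGaussian (n := n) 6).const_mul (μ ^ 2 * L ^ 2 / 2)
  refine (integral_mono (hg.integrable_norm_diffQuot_sq hμ x) (h1.add h2)
    (hg.norm_diffQuot_sq_le hμ x)).trans ?_
  simp only [Pi.add_apply]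
  rw [integral_add h1 h2, integral_const_mul, integral_const_mul,
    integral_inner_sq_mul_norm_sq_stdGaussian]
  have h3 := mul_le_mul_of_nonneg_left (integral_norm_pow_six_stdGaussian_le (n := n))
    (show 0 ≤ μ ^ 2 * L ^ 2 / 2 by positivity)
  linarith

variable {Ξ : Type*} [MeasurableSpace Ξ] {F : (𝔼 n) → Ξ → ℝ} {σ : ℝ} {Q : Measure Ξ}

lemma measurable_diffQuot (hF : Measurable (Function.uncurry F)) (μ : ℝ) :
    Measurable fun p : (𝔼 n) × Ξ × (𝔼 n) => diffQuot (fun y => F y p.2.1) μ p.1 p.2.2 := by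
  have h1 : Measurable fun p : (𝔼 n) × Ξ × (𝔼 n) => F (p.1 + μ • p.2.2) p.2.1 :=
    hF.comp (f := fun p : (𝔼 n) × Ξ × (𝔼 n) => (p.1 + μ • p.2.2, p.2.1)) (by fun_prop)
  have h2 : Measurable fun p : (𝔼 n) × Ξ × (𝔼 n) => F p.1 p.2.1 :=
    hF.comp (f := fun p : (𝔼 n) × Ξ × (𝔼 n) => (p.1, p.2.1)) (by fun_prop)
  exact ((h1.sub h2).div_const μ).smul measurable_snd.snd

lemma measurable_diffQuot_prod (hF : Measurable (Function.uncurry F)) (μ : ℝ) (x : 𝔼 n) :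
    Measurable fun p : Ξ × (𝔼 n) => diffQuot (fun y => F y p.1) μ x p.2 :=
  (measurable_diffQuot hF μ).comp (f := fun p : Ξ × (𝔼 n) => (x, p)) (by fun_prop)

variable [IsProbabilityMeasure Q]

lemma OracleLaw.integrable_norm_gradient_sq (hQ : OracleLaw F f L σ Q) (x : 𝔼 n) :
    Integrable (fun ξ => ‖gradient (fun y => F y ξ) x‖ ^ 2) Q := by
  refine (((hQ.var_integrable x).const_mul 2).add
    (integrable_const (2 * ‖gradient f x‖ ^ 2))).mono'
    ((hQ.grad_integrable x).aestronglyMeasurable.norm.pow 2) (.of_forall fun ξ => ?_)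
  rw [norm_pow, norm_norm]
  set a := gradient (fun y => F y ξ) x
  have h : ‖a‖ ≤ ‖a - gradient f x‖ + ‖gradient f x‖ := by
    simpa using norm_add_le (a - gradient f x) (gradient f x)
  calc ‖a‖ ^ 2 ≤ (‖a - gradient f x‖ + ‖gradient f x‖) ^ 2 := by gcongr
    _ ≤ 2 * (‖a - gradient f x‖ ^ 2 + ‖gradient f x‖ ^ 2) := add_sq_le
    _ = _ := by simp only [Pi.add_apply]; ring

lemma OracleLaw.integral_norm_gradient_sq_le (hQ : OracleLaw F f L σ Q) (x : 𝔼 n) :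
    ∫ ξ, ‖gradient (fun y => F y ξ) x‖ ^ 2 ∂Q ≤ ‖gradient f x‖ ^ 2 + σ ^ 2 := by
  have hi : Integrable (fun ξ => (inner ℝ (gradient f x) (gradient (fun y => F y ξ) x) : ℝ)) Q :=
    (hQ.grad_integrable x).const_inner _
  have h := hQ.var_le x
  simp_rw [norm_sub_sq_real] at h
  have e : ∫ ξ, (‖gradient (fun y => F y ξ) x‖ ^ 2
      - 2 * inner ℝ (gradient (fun y => F y ξ) x) (gradient f x) + ‖gradient f x‖ ^ 2) ∂Q =
      ∫ ξ, ‖gradient (fun y => F y ξ) x‖ ^ 2 ∂Q - 2 * ‖gradient f x‖ ^ 2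
        + ‖gradient f x‖ ^ 2 := by
    simp_rw [real_inner_comm (gradient f x)]
    have hs : Integrable (fun ξ => ‖gradient (fun y => F y ξ) x‖ ^ 2
      - 2 * inner ℝ (gradient f x) (gradient (fun y => F y ξ) x)) Q :=
      (hQ.integrable_norm_gradient_sq x).sub (hi.const_mul 2)
    rw [integral_add hs (integrable_const _),
      integral_sub (hQ.integrable_norm_gradient_sq x) (hi.const_mul 2), integral_const_mul,
      integral_inner (hQ.grad_integrable x), hQ.grad_mean, real_inner_self_eq_norm_sq]
    simp
  rw [e] at h
  linarith

lemma OracleLaw.integrable_norm_diffQuot_sq (hF : Measurable (Function.uncurry F)) (hμ : 0 < μ)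
    (hQ : OracleLaw F f L σ Q) (x : 𝔼 n) :
    Integrable (fun p : Ξ × (𝔼 n) => ‖diffQuot (fun y => F y p.1) μ x p.2‖ ^ 2)
      (Q.prod (stdGaussian (𝔼 n))) := by
  have hm : AEStronglyMeasurable
      (fun p : Ξ × (𝔼 n) => ‖diffQuot (fun y => F y p.1) μ x p.2‖ ^ 2)
      (Q.prod (stdGaussian (𝔼 n))) :=
    ((measurable_diffQuot_prod hF μ x).norm.pow_const 2).aestronglyMeasurable
  rw [integrable_prod_iff hm]
  refine ⟨?_, (((hQ.integrable_norm_gradient_sq x).const_mul (2 * (n + 2))).add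
    (integrable_const (15 / 2 * μ ^ 2 * L ^ 2 * n ^ 3))).mono' hm.norm.integral_prod_right' ?_⟩
  · filter_upwards [hQ.smooth] with ξ hξ using hξ.integrable_norm_diffQuot_sq hμ x
  · filter_upwards [hQ.smooth] with ξ hξ
    rw [Real.norm_of_nonneg (by positivity)]
    simp_rw [norm_pow, norm_norm]
    exact hξ.integral_norm_diffQuot_sq_le hμ x

lemma OracleLaw.integral_norm_diffQuot_sq_le (hF : Measurable (Function.uncurry F)) (hμ : 0 < μ)
    (hQ : OracleLaw F f L σ Q) (x : 𝔼 n) :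
    ∫ p : Ξ × (𝔼 n), ‖diffQuot (fun y => F y p.1) μ x p.2‖ ^ 2 ∂(Q.prod (stdGaussian (𝔼 n)))
      ≤ momentBound f L σ μ x := by
  have hi := hQ.integrable_norm_diffQuot_sq hF hμ x
  rw [integral_prod _ hi]
  have h1 := (hQ.integrable_norm_gradient_sq x).const_mul (2 * ((n : ℝ) + 2))
  have h2 := integrable_const (μ := Q) (15 / 2 * μ ^ 2 * L ^ 2 * n ^ 3)
  calc _ ≤ ∫ ξ, (2 * ((n : ℝ) + 2) * ‖gradient (fun y => F y ξ) x‖ ^ 2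
          + 15 / 2 * μ ^ 2 * L ^ 2 * n ^ 3) ∂Q := by
        refine integral_mono_ae hi.integral_prod_left (h1.add h2) ?_
        filter_upwards [hQ.smooth] with ξ hξ using hξ.integral_norm_diffQuot_sq_le hμ x
    _ ≤ _ := by
        rw [integral_add h1 h2, integral_const_mul, momentBound]
        have := hQ.integral_norm_gradient_sq_le x
        simp only [integral_const, probReal_univ, one_smul]
        gcongr

lemma OracleLaw.integrable_diffQuot (hF : Measurable (Function.uncurry F)) (hμ : 0 < μ)
    (hQ : OracleLaw F f L σ Q) (x : 𝔼 n) :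
    Integrable (fun p : Ξ × (𝔼 n) => diffQuot (fun y => F y p.1) μ x p.2)
      (Q.prod (stdGaussian (𝔼 n))) := by
  refine ((integrable_const (1 : ℝ)).add (hQ.integrable_norm_diffQuot_sq hF hμ x)).mono'
    (measurable_diffQuot_prod hF μ x).aestronglyMeasurable (.of_forall fun p => ?_)
  simp only [Pi.add_apply]
  nlinarith [sq_nonneg (‖diffQuot (fun y => F y p.1) μ x p.2‖ - 1)]

/-- Integrating over the noise first replaces `F` by `f` at both query points. The result does not
involve `Q`, which is why history-dependent noise is harmless. -/
lemma OracleLaw.integral_diffQuot (hF : Measurable (Function.uncurry F)) (hμ : 0 < μ)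
    (hQ : OracleLaw F f L σ Q) (x : 𝔼 n) :
    ∫ p : Ξ × (𝔼 n), diffQuot (fun y => F y p.1) μ x p.2 ∂(Q.prod (stdGaussian (𝔼 n)))
      = meanQuot f μ x := by
  rw [integral_prod_symm _ (hQ.integrable_diffQuot hF hμ x), meanQuot]
  congr with u : 1
  simp only [diffQuot]
  rw [integral_smul_const, integral_div,
    integral_sub (hQ.value_integrable _) (hQ.value_integrable _), hQ.value_mean, hQ.value_mean]

lemma OracleLaw.integral_inner_diffQuot (hF : Measurable (Function.uncurry F)) (hμ : 0 < μ)
    (hQ : OracleLaw F f L σ Q) (x a : 𝔼 n) :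
    ∫ p : Ξ × (𝔼 n), inner ℝ a (diffQuot (fun y => F y p.1) μ x p.2)
      ∂(Q.prod (stdGaussian (𝔼 n))) = inner ℝ a (meanQuot f μ x) := by
  rw [integral_inner (hQ.integrable_diffQuot hF hμ x), hQ.integral_diffQuot hF hμ]

/-- A nonnegative function of the estimate that is at most quadratic is integrated by means of
the first two moments. -/
lemma OracleLaw.lintegral_le_of_quadratic_bound (hF : Measurable (Function.uncurry F))
    (hμ : 0 < μ) (hQ : OracleLaw F f L σ Q) (x w : 𝔼 n) {a k : ℝ} (ha : 0 ≤ a)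
    {φ : (𝔼 n) → ℝ} (h0 : ∀ v, 0 ≤ φ v) (hφ : ∀ v, φ v ≤ a * ‖v‖ ^ 2 + inner ℝ w v + k) :
    0 ≤ a * momentBound f L σ μ x + inner ℝ w (meanQuot f μ x) + k ∧
    ∫⁻ p : Ξ × (𝔼 n), ENNReal.ofReal (φ (diffQuot (fun y => F y p.1) μ x p.2))
        ∂(Q.prod (stdGaussian (𝔼 n)))
      ≤ ENNReal.ofReal (a * momentBound f L σ μ x + inner ℝ w (meanQuot f μ x) + k) := by
  set d : Ξ × (𝔼 n) → (𝔼 n) := fun p => diffQuot (fun y => F y p.1) μ x p.2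
  set ν := Q.prod (stdGaussian (𝔼 n))
  have h1 : Integrable (fun p => a * ‖d p‖ ^ 2) ν :=
    (hQ.integrable_norm_diffQuot_sq hF hμ x).const_mul a
  have h2 : Integrable (fun p => (inner ℝ w (d p) : ℝ)) ν :=
    (hQ.integrable_diffQuot hF hμ x).const_inner w
  have h12 : Integrable (fun p => a * ‖d p‖ ^ 2 + inner ℝ w (d p)) ν := h1.add h2
  have hk := integrable_const (μ := ν) k
  have hi : Integrable (fun p => a * ‖d p‖ ^ 2 + inner ℝ w (d p) + k) ν := h12.add hk
  have h3 : ∫ p, (a * ‖d p‖ ^ 2 + inner ℝ w (d p) + k) ∂ν ≤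
      a * momentBound f L σ μ x + inner ℝ w (meanQuot f μ x) + k := by
    rw [integral_add h12 hk, integral_add h1 h2, integral_const_mul,
      hQ.integral_inner_diffQuot hF hμ]
    have h3 := hQ.integral_norm_diffQuot_sq_le hF hμ x
    simp only [integral_const, probReal_univ, one_smul]
    gcongr
  have hp : ∀ p, 0 ≤ a * ‖d p‖ ^ 2 + inner ℝ w (d p) + k := fun p => (h0 _).trans (hφ _)
  refine ⟨(integral_nonneg hp).trans h3, ?_⟩
  refine (lintegral_mono fun p => ENNReal.ofReal_le_ofReal (hφ (d p))).trans ?_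
  rw [← ofReal_integral_eq_lintegral_ofReal hi (.of_forall hp)]
  exact ENNReal.ofReal_le_ofReal h3

/-- Adding a centered estimate increases the mean square by at most `momentBound`. -/
lemma OracleLaw.lintegral_norm_add_diffQuot_sq_le (hF : Measurable (Function.uncurry F))
    (hμ : 0 < μ) (hQ : OracleLaw F f L σ Q) (x a : 𝔼 n) :
    ∫⁻ p : Ξ × (𝔼 n), ENNReal.ofReal
        (‖a + (diffQuot (fun y => F y p.1) μ x p.2 - meanQuot f μ x)‖ ^ 2)
        ∂(Q.prod (stdGaussian (𝔼 n)))
      ≤ ENNReal.ofReal (‖a‖ ^ 2) + ENNReal.ofReal (momentBound f L σ μ x) := by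
  set m := meanQuot f μ x with hm
  have e : ∀ v : 𝔼 n, ‖a + (v - m)‖ ^ 2 =
      1 * ‖v‖ ^ 2 + inner ℝ ((2 : ℝ) • (a - m)) v + ‖a - m‖ ^ 2 := by
    intro v
    rw [show a + (v - m) = v + (a - m) by abel, norm_add_sq_real, real_inner_comm,
      real_inner_smul_left, one_mul]
  refine (hQ.lintegral_le_of_quadratic_bound hF hμ x ((2 : ℝ) • (a - m)) zero_le_one
    (φ := fun v => ‖a + (v - m)‖ ^ 2) (fun v => by positivity) fun v => (e v).le).2.trans ?_
  rw [← ENNReal.ofReal_add (by positivity) (by unfold momentBound; positivity)]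
  apply ENNReal.ofReal_le_ofReal
  -- The expansion at `v = m` shows that the linear and constant terms average to `‖a‖² - ‖m‖²`.
  have h4 := e m
  rw [sub_self, add_zero] at h4
  have h5 : 0 ≤ ‖m‖ ^ 2 := by positivity
  rw [← hm]
  linarith

/-- The expected decrease of the objective in one step of stepsize `t`. -/
lemma OracleLaw.lintegral_sub_diffQuot_add_le (hF : Measurable (Function.uncurry F)) (hL : 0 < L)
    (hμ : 0 < μ) (hf : IsC11 L f) (hQ : OracleLaw F f L σ Q) {t fmin : ℝ} (ht : 0 ≤ t)
    (hmin : ∀ y, fmin ≤ f y) (hc : 0 ≤ t - 2 * L * (n + 4) * t ^ 2) (x : 𝔼 n) :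
    ∫⁻ p : Ξ × (𝔼 n), ENNReal.ofReal
        (f (x - t • diffQuot (fun y => F y p.1) μ x p.2) - fmin) ∂(Q.prod (stdGaussian (𝔼 n)))
      + ENNReal.ofReal ((t - 2 * L * (n + 4) * t ^ 2) / 2 * ‖gradient f x‖ ^ 2)
      ≤ ENNReal.ofReal (f x - fmin) + ENNReal.ofReal (t / 2 * biasBound n L μ ^ 2 +
        L / 2 * t ^ 2 * (2 * (n + 4) * σ ^ 2 + 15 / 2 * μ ^ 2 * L ^ 2 * n ^ 3)) := by
  set m := meanQuot f μ x with hm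
  have hle : ∀ v : 𝔼 n, f (x - t • v) - fmin ≤
      L / 2 * t ^ 2 * ‖v‖ ^ 2 + inner ℝ (-(t • gradient f x)) v + (f x - fmin) := by
    intro v
    have := hf.le_add x (-(t • v))
    rw [norm_neg, norm_smul, Real.norm_of_nonneg ht, ← sub_eq_add_neg, inner_neg_right,
      real_inner_smul_right] at this
    rw [inner_neg_left, real_inner_smul_left]
    linarith
  have hx := hmin x
  obtain ⟨h, hup⟩ := hQ.lintegral_le_of_quadratic_bound hF hμ x (-(t • gradient f x))
    (a := L / 2 * t ^ 2) (by positivity) (φ := fun v => f (x - t • v) - fmin)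
    (fun v => sub_nonneg.2 (hmin _)) hle
  rw [← hm] at h hup
  have hbias := hf.norm_meanQuot_sub_le hL hμ x
  have hb2 : ‖m - gradient f x‖ ^ 2 ≤ biasBound n L μ ^ 2 := by gcongr
  rw [norm_sub_sq_real, real_inner_comm] at hb2
  set G := ‖gradient f x‖ ^ 2 with hG
  -- Polarization turns the inner product into half of `‖m - ∇f‖² - ‖m‖² - ‖∇f‖²`; the term `-‖m‖²`
  -- is dropped.
  have hinner : inner ℝ (-(t • gradient f x)) m ≤ t * (biasBound n L μ ^ 2 / 2 - G / 2) := by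
    rw [inner_neg_left, real_inner_smul_left, ← mul_neg]
    have : 0 ≤ ‖m‖ ^ 2 := by positivity
    apply mul_le_mul_of_nonneg_left _ ht
    linarith
  -- Weakening `n + 2` to `n + 4` makes the total coefficient of `G` exactly minus half the
  -- numerator of `P_R`.
  have hmom : L / 2 * t ^ 2 * momentBound f L σ μ x ≤ L / 2 * t ^ 2 *
      (2 * (n + 4) * (G + σ ^ 2) + 15 / 2 * μ ^ 2 * L ^ 2 * n ^ 3) := by
    rw [momentBound]
    gcongr
    norm_num
  have hd : 0 ≤ t / 2 * biasBound n L μ ^ 2 +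
        L / 2 * t ^ 2 * (2 * (n + 4) * σ ^ 2 + 15 / 2 * μ ^ 2 * L ^ 2 * n ^ 3) := by positivity
  rw [← ENNReal.ofReal_add (by linarith) hd]
  have hcG : 0 ≤ (t - 2 * L * (n + 4) * t ^ 2) / 2 * G := by positivity
  refine (add_le_add hup le_rfl).trans ?_
  rw [← ENNReal.ofReal_add h hcG]
  apply ENNReal.ofReal_le_ofReal
  linarith

end Estimator

/-! ### Integration along a stream of samples -/

section JointLaw

variable {Ω 𝓗 Ξ E : Type*} [MeasurableSpace Ω] [MeasurableSpace 𝓗] [MeasurableSpace Ξ]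
  [MeasurableSpace E] [StandardBorelSpace Ξ] [Nonempty Ξ]
  {Pr : Measure Ω} [IsFiniteMeasure Pr] {H : Ω → 𝓗} {ξ : Ω → Ξ} {u : Ω → E}

/-- Disintegrate the law of `ξ` over the history; independence of the direction makes the joint law
a product with the law of `u`. -/
lemma lintegral_comp_history_eq (hH : Measurable H) (hξ : Measurable ξ) (hu : Measurable u)
    (hind : IndepFun u (fun ω => (H ω, ξ ω)) Pr) {ψ : 𝓗 → Ξ × E → ENNReal}
    (hψ : Measurable (Function.uncurry ψ)) :
    ∫⁻ ω, ψ (H ω) (ξ ω, u ω) ∂Pr =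
      ∫⁻ h, ∫⁻ p, ψ h p ∂((condDistrib ξ H Pr h).prod (Pr.map u)) ∂(Pr.map H) := by
  have hψ' : Measurable fun z : (𝓗 × Ξ) × E => ψ z.1.1 (z.1.2, z.2) :=
    hψ.comp (f := fun z : (𝓗 × Ξ) × E => (z.1.1, (z.1.2, z.2))) (by fun_prop)
  have hlaw : Pr.map (fun ω => ((H ω, ξ ω), u ω)) =
      ((Pr.map H) ⊗ₘ condDistrib ξ H Pr).prod (Pr.map u) := by
    rw [compProd_map_condDistrib hξ.aemeasurable]
    exact (indepFun_iff_map_prod_eq_prod_map_map (hH.prodMk hξ).aemeasurable hu.aemeasurable).1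
      hind.symm
  calc ∫⁻ ω, ψ (H ω) (ξ ω, u ω) ∂Pr
      = ∫⁻ z, ψ z.1.1 (z.1.2, z.2) ∂(Pr.map (fun ω => ((H ω, ξ ω), u ω))) :=
        (lintegral_map hψ' ((hH.prodMk hξ).prodMk hu)).symm
    _ = ∫⁻ y, ∫⁻ v, ψ y.1 (y.2, v) ∂(Pr.map u) ∂((Pr.map H) ⊗ₘ condDistrib ξ H Pr) := by
        rw [hlaw, lintegral_prod _ hψ'.aemeasurable]
    _ = ∫⁻ h, ∫⁻ z, ∫⁻ v, ψ h (z, v) ∂(Pr.map u) ∂(condDistrib ξ H Pr h) ∂(Pr.map H) :=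
        Measure.lintegral_compProd hψ'.lintegral_prod_right'
    _ = _ := by
        congr with h
        rw [lintegral_prod]
        exact (hψ.comp (f := fun p : Ξ × E => (h, p)) (by fun_prop)).aemeasurable

lemma lintegral_comp_history_le (hH : Measurable H) (hξ : Measurable ξ) (hu : Measurable u)
    (hind : IndepFun u (fun ω => (H ω, ξ ω)) Pr) {ψ : 𝓗 → Ξ × E → ENNReal}
    (hψ : Measurable (Function.uncurry ψ)) {χ : 𝓗 → ENNReal} (hχ : Measurable χ)
    (hle : ∀ᵐ h ∂(Pr.map H),
      ∫⁻ p, ψ h p ∂((condDistrib ξ H Pr h).prod (Pr.map u)) ≤ χ h) :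
    ∫⁻ ω, ψ (H ω) (ξ ω, u ω) ∂Pr ≤ ∫⁻ ω, χ (H ω) ∂Pr := by
  rw [lintegral_comp_history_eq hH hξ hu hind hψ, ← lintegral_map hχ hH]
  exact lintegral_mono_ae hle

end JointLaw

/-! ### Finite histories as infinite sequences -/

section ExtendSeq

variable {α : Type*}

/-- Extension of a finite sequence by a default value. -/
def extendSeq (a : α) {k : ℕ} (q : Fin k → α) : ℕ → α :=
  fun j => if h : j < k then q ⟨j, h⟩ else a

lemma extendSeq_of_lt (a : α) {k : ℕ} (q : Fin k → α) {j : ℕ} (h : j < k) :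
    extendSeq a q j = q ⟨j, h⟩ := dif_pos h

lemma measurable_extendSeq [MeasurableSpace α] (a : α) (k : ℕ) :
    Measurable (extendSeq a : (Fin k → α) → ℕ → α) := by
  refine measurable_pi_iff.2 fun j => ?_
  by_cases h : j < k
  · simp only [extendSeq, h, dite_true]
    exact measurable_pi_apply _
  · simp only [extendSeq, h, dite_false]
    exact measurable_const

end ExtendSeq

/-! ### Descent and error accumulation along a stream of samples -/

section Stream

variable {n : ℕ}

local notation "𝔼" n => EuclideanSpace ℝ (Fin n)

variable {Ω 𝓗 Ξ : Type*}

/-- The iterates of the stochastic gradient method on a sequence of samples. -/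
noncomputable def sgIter (F : (𝔼 n) → Ξ → ℝ) (μ t : ℝ) (x₁ : 𝔼 n) (p : ℕ → Ξ × (𝔼 n)) :
    ℕ → (𝔼 n)
  | 0 => x₁
  | k + 1 => sgIter F μ t x₁ p k
      - t • diffQuot (fun y => F y (p k).1) μ (sgIter F μ t x₁ p k) (p k).2

/-- The sum of the first `k` centered gradient estimates at `x`. -/
noncomputable def errSum (F : (𝔼 n) → Ξ → ℝ) (μ : ℝ) (m x : 𝔼 n) (p : ℕ → Ξ × (𝔼 n)) (k : ℕ) :
    𝔼 n :=
  ∑ j ∈ Finset.range k, (diffQuot (fun y => F y (p j).1) μ x (p j).2 - m)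

variable {F : (𝔼 n) → Ξ → ℝ} {μ t : ℝ} {x₁ : 𝔼 n}

/-- Makes the padding by `extendSeq` harmless: a finite history already determines the iterate. -/
lemma sgIter_congr {p q : ℕ → Ξ × (𝔼 n)} {k : ℕ} (h : ∀ j < k, p j = q j) :
    sgIter F μ t x₁ p k = sgIter F μ t x₁ q k := by
  induction k with
  | zero => rfl
  | succ k ih =>
    rw [sgIter, sgIter, ih fun j hj => h j (hj.trans k.lt_succ_self), h k k.lt_succ_self]

lemma measurable_diffQuot_comp {β : Type*} [MeasurableSpace β] [MeasurableSpace Ξ]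
    (hF : Measurable (Function.uncurry F)) {x : β → (𝔼 n)} {p : β → Ξ × (𝔼 n)}
    (hx : Measurable x) (hp : Measurable p) :
    Measurable fun z => diffQuot (fun y => F y (p z).1) μ (x z) (p z).2 := by
  have h := (measurable_diffQuot hF μ).comp (hx.prodMk hp)
  exact h

lemma errSum_congr {m x : 𝔼 n} {p q : ℕ → Ξ × (𝔼 n)} {k : ℕ} (h : ∀ j < k, p j = q j) :
    errSum F μ m x p k = errSum F μ m x q k :=
  Finset.sum_congr rfl fun j hj => by rw [h j (Finset.mem_range.1 hj)]

variable [MeasurableSpace Ω] [MeasurableSpace 𝓗] [MeasurableSpace Ξ]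

lemma measurable_sgIter (hF : Measurable (Function.uncurry F)) (k : ℕ) :
    Measurable fun p : ℕ → Ξ × (𝔼 n) => sgIter F μ t x₁ p k := by
  induction k with
  | zero => exact measurable_const
  | succ k ih =>
    exact ih.sub ((measurable_diffQuot_comp hF ih (measurable_pi_apply k)).const_smul t)

lemma measurable_errSum {β : Type*} [MeasurableSpace β] (hF : Measurable (Function.uncurry F))
    {m x : β → (𝔼 n)} {p : β → ℕ → Ξ × (𝔼 n)} (hm : Measurable m) (hx : Measurable x)
    (hp : Measurable p) (k : ℕ) :
    Measurable fun z => errSum F μ (m z) (x z) (p z) k := by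
  have h : ∀ j, Measurable fun z =>
      diffQuot (fun y => F y (p z j).1) μ (x z) (p z j).2 - m z :=
    fun j => (measurable_diffQuot_comp hF hx ((measurable_pi_apply j).comp hp)).sub hm
  unfold errSum
  exact Finset.measurable_sum _ fun j _ => h j

/-- The initial information and the first `k` samples of a stream. -/
def pastSamples (A : Ω → 𝓗) (ξ : ℕ → Ω → Ξ) (u : ℕ → Ω → (𝔼 n)) (k : ℕ) (ω : Ω) :
    𝓗 × (Fin k → Ξ × (𝔼 n)) :=
  (A ω, fun j => (ξ j ω, u j ω))

variable [StandardBorelSpace Ξ] [Nonempty Ξ]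

/-- A stream of `N` samples that satisfies the oracle assumptions conditionally on the initial
information `A` and on the previous samples. -/
structure IsOracleStream (Pr : Measure Ω) [IsFiniteMeasure Pr] (A : Ω → 𝓗) (ξ : ℕ → Ω → Ξ)
    (u : ℕ → Ω → (𝔼 n)) (F : (𝔼 n) → Ξ → ℝ) (f : (𝔼 n) → ℝ) (L σ : ℝ) (N : ℕ) : Prop where
  measurable_init : Measurable A
  measurable_ξ : ∀ k, Measurable (ξ k)
  measurable_u : ∀ k, Measurable (u k)
  oracle : ∀ k < N, ∀ᵐ h ∂(Pr.map (pastSamples A ξ u k)),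
    OracleLaw F f L σ (condDistrib (ξ k) (pastSamples A ξ u k) Pr h)
  gaussian : ∀ k < N, Pr.map (u k) = stdGaussian (𝔼 n)
  indep : ∀ k < N, IndepFun (u k) (fun ω => (pastSamples A ξ u k ω, ξ k ω)) Pr

variable {Pr : Measure Ω} [IsFiniteMeasure Pr] {A : Ω → 𝓗} {ξ : ℕ → Ω → Ξ}
  {u : ℕ → Ω → (𝔼 n)} {f : (𝔼 n) → ℝ} {L σ : ℝ} {N : ℕ}

namespace IsOracleStream

lemma measurable_pastSamples (h : IsOracleStream Pr A ξ u F f L σ N) (k : ℕ) :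
    Measurable (pastSamples A ξ u k) :=
  h.measurable_init.prodMk (measurable_pi_iff.2 fun j =>
    (h.measurable_ξ j).prodMk (h.measurable_u j))

lemma measurable_samples (h : IsOracleStream Pr A ξ u F f L σ N) :
    Measurable fun ω j => (ξ j ω, u j ω) :=
  measurable_pi_iff.2 fun j => (h.measurable_ξ j).prodMk (h.measurable_u j)

/-- The current iterate and the weight are functions of the history, so the one-step estimate
applies under the conditional law. Allowing every weight `w` amounts to conditioning on `A`. -/
lemma lintegral_descent (h : IsOracleStream Pr A ξ u F f L σ N)
    (hF : Measurable (Function.uncurry F)) (hL : 0 < L) (hμ : 0 < μ) (hf : IsC11 L f) {fmin : ℝ}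
    (ht : 0 ≤ t) (hmin : ∀ y, fmin ≤ f y) (hc : 0 ≤ t - 2 * L * (n + 4) * t ^ 2)
    {w : 𝓗 → ENNReal} (hw : Measurable w) {k : ℕ} (hk : k < N) :
    ∫⁻ ω, w (A ω) * ENNReal.ofReal
        (f (sgIter F μ t x₁ (fun j => (ξ j ω, u j ω)) (k + 1)) - fmin) ∂Pr
      + ∫⁻ ω, w (A ω) * ENNReal.ofReal ((t - 2 * L * (n + 4) * t ^ 2) / 2
        * ‖gradient f (sgIter F μ t x₁ (fun j => (ξ j ω, u j ω)) k)‖ ^ 2) ∂Pr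
      ≤ ∫⁻ ω, w (A ω) * ENNReal.ofReal
        (f (sgIter F μ t x₁ (fun j => (ξ j ω, u j ω)) k) - fmin) ∂Pr
      + ENNReal.ofReal (t / 2 * biasBound n L μ ^ 2 +
        L / 2 * t ^ 2 * (2 * (n + 4) * σ ^ 2 + 15 / 2 * μ ^ 2 * L ^ 2 * n ^ 3))
        * ∫⁻ ω, w (A ω) ∂Pr := by
  set c := (t - 2 * L * (n + 4) * t ^ 2) / 2
  set d := t / 2 * biasBound n L μ ^ 2 +
        L / 2 * t ^ 2 * (2 * (n + 4) * σ ^ 2 + 15 / 2 * μ ^ 2 * L ^ 2 * n ^ 3)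
  have hgc := hf.continuous_gradient hL.le
  have hfc := hf.1.continuous
  let a : Ξ × (𝔼 n) := (Classical.arbitrary Ξ, 0)
  let X : 𝓗 × (Fin k → Ξ × (𝔼 n)) → (𝔼 n) := fun z => sgIter F μ t x₁ (extendSeq a z.2) k
  have hX : Measurable X := (measurable_sgIter hF k).comp
    ((measurable_extendSeq a k).comp measurable_snd)
  have hXk : ∀ ω, sgIter F μ t x₁ (fun j => (ξ j ω, u j ω)) k = X (pastSamples A ξ u k ω) :=
    fun ω => sgIter_congr fun j hj =>
      (extendSeq_of_lt a (pastSamples A ξ u k ω).2 hj).symm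
  have hXm : Measurable fun ω => sgIter F μ t x₁ (fun j => (ξ j ω, u j ω)) k :=
    (measurable_sgIter hF k).comp h.measurable_samples
  have hm1 : Measurable fun ω => w (A ω) * ENNReal.ofReal (c
        * ‖gradient f (sgIter F μ t x₁ (fun j => (ξ j ω, u j ω)) k)‖ ^ 2) :=
    (hw.comp h.measurable_init).mul
      ((((hgc.measurable.comp hXm).norm.pow_const 2).const_mul c).ennreal_ofReal)
  have hwA : Measurable fun ω => w (A ω) := hw.comp h.measurable_init
  rw [← lintegral_add_right _ hm1, ← lintegral_const_mul _ hwA,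
    ← lintegral_add_right _ (hwA.const_mul _)]
  simp only [sgIter, hXk]
  have hz : Measurable fun z : (𝓗 × (Fin k → Ξ × (𝔼 n))) × (Ξ × (𝔼 n)) =>
      diffQuot (fun y => F y z.2.1) μ (X z.1) z.2.2 :=
    measurable_diffQuot_comp hF (hX.comp measurable_fst) measurable_snd
  have hn : Measurable fun z : 𝓗 × (Fin k → Ξ × (𝔼 n)) =>
      ENNReal.ofReal (c * ‖gradient f (X z)‖ ^ 2) :=
    ((((hgc.measurable.comp hX).norm.pow_const 2).const_mul c).ennreal_ofReal)
  have hmain := lintegral_comp_history_le (h.measurable_pastSamples k) (h.measurable_ξ k)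
    (h.measurable_u k) (h.indep k hk)
    (ψ := fun z p => w z.1 * ENNReal.ofReal
        (f (X z - t • diffQuot (fun y => F y p.1) μ (X z) p.2) - fmin)
        + w z.1 * ENNReal.ofReal (c * ‖gradient f (X z)‖ ^ 2))
    (χ := fun z => w z.1 * ENNReal.ofReal (f (X z) - fmin) + ENNReal.ofReal d * w z.1)
    (by
      refine Measurable.add ?_ ?_
      · exact (hw.comp measurable_fst.fst).mul ((hfc.measurable.comp
          ((hX.comp measurable_fst).sub (hz.const_smul t))).sub_const fmin).ennreal_ofReal
      · exact (hw.comp measurable_fst.fst).mul (hn.comp measurable_fst))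
    (by
      refine Measurable.add ?_ ?_
      · exact (hw.comp measurable_fst).mul
          ((hfc.measurable.comp hX).sub_const fmin).ennreal_ofReal
      · exact (hw.comp measurable_fst).const_mul _)
    (by
      filter_upwards [h.oracle k hk] with z hQ
      rw [h.gaussian k hk, lintegral_add_right _ measurable_const, lintegral_const, measure_univ,
        mul_one, lintegral_const_mul, mul_comm (ENNReal.ofReal d), ← mul_add, ← mul_add]
      · refine mul_le_mul_right ?_ _
        exact hQ.lintegral_sub_diffQuot_add_le hF hL hμ hf ht hmin hc (X z)
      · exact ((hfc.measurable.comp (((measurable_diffQuot_prod hF μ (X z)).const_smul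
          t).const_sub (X z))).sub_const fmin).ennreal_ofReal)
  exact hmain

/-- The descent inequalities telescope; keeping the last objective gap on the left lets the
induction close. -/
lemma sum_lintegral_gradient_le (h : IsOracleStream Pr A ξ u F f L σ N)
    (hF : Measurable (Function.uncurry F)) (hL : 0 < L) (hμ : 0 < μ) (hf : IsC11 L f) {fmin : ℝ}
    (ht : 0 ≤ t) (hmin : ∀ y, fmin ≤ f y) (hc : 0 ≤ t - 2 * L * (n + 4) * t ^ 2)
    {w : 𝓗 → ENNReal} (hw : Measurable w) {K : ℕ} (hK : K ≤ N) :
    ∫⁻ ω, w (A ω) * ENNReal.ofReal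
        (f (sgIter F μ t x₁ (fun j => (ξ j ω, u j ω)) K) - fmin) ∂Pr
      + ∑ k ∈ Finset.range K, ∫⁻ ω, w (A ω) * ENNReal.ofReal ((t - 2 * L * (n + 4) * t ^ 2) / 2
        * ‖gradient f (sgIter F μ t x₁ (fun j => (ξ j ω, u j ω)) k)‖ ^ 2) ∂Pr
      ≤ ENNReal.ofReal (f x₁ - fmin + K * (t / 2 * biasBound n L μ ^ 2 +
        L / 2 * t ^ 2 * (2 * (n + 4) * σ ^ 2 + 15 / 2 * μ ^ 2 * L ^ 2 * n ^ 3)))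
        * ∫⁻ ω, w (A ω) ∂Pr := by
  have hd : 0 ≤ t / 2 * biasBound n L μ ^ 2 +
        L / 2 * t ^ 2 * (2 * (n + 4) * σ ^ 2 + 15 / 2 * μ ^ 2 * L ^ 2 * n ^ 3) := by positivity
  induction K with
  | zero =>
    simp only [sgIter, Finset.range_zero, Finset.sum_empty, add_zero, CharP.cast_eq_zero, zero_mul]
    have hwA : Measurable fun ω => w (A ω) := hw.comp h.measurable_init
    rw [lintegral_mul_const _ hwA, mul_comm]
  | succ K ih =>
    have h1 := h.lintegral_descent (x₁ := x₁) hF hL hμ hf ht hmin hc hw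
      (Nat.lt_of_succ_le hK)
    have h2 := ih ((Nat.le_succ K).trans hK)
    rw [Finset.sum_range_succ, add_comm (∑ k ∈ Finset.range K, _), ← add_assoc]
    refine (add_le_add h1 le_rfl).trans ?_
    rw [add_right_comm]
    refine (add_le_add h2 le_rfl).trans ?_
    rw [← add_mul, ← ENNReal.ofReal_add _ hd]
    · apply le_of_eq
      push_cast
      ring_nf
    · have := hmin x₁
      have : 0 ≤ f x₁ - fmin := by linarith
      positivity

/-- The point `X (A ω)` is fixed by the history, so the next centred estimate has conditional mean
zero. Cross terms vanish and each sample adds at most one `momentBound`. -/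
lemma lintegral_errSum_le (h : IsOracleStream Pr A ξ u F f L σ N)
    (hF : Measurable (Function.uncurry F)) (hμ : 0 < μ) (hL : 0 < L) (hf : IsC11 L f)
    {X : 𝓗 → (𝔼 n)} (hX : Measurable X) {K : ℕ} (hK : K ≤ N) :
    ∫⁻ ω, ENNReal.ofReal (‖errSum F μ (meanQuot f μ (X (A ω))) (X (A ω))
        (fun j => (ξ j ω, u j ω)) K‖ ^ 2) ∂Pr
      ≤ K * ∫⁻ ω, ENNReal.ofReal (momentBound f L σ μ (X (A ω))) ∂Pr := by
  have hV : Measurable (momentBound f L σ μ) := by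
    have := (hf.continuous_gradient hL.le).measurable
    unfold momentBound
    fun_prop
  have hm := hf.measurable_meanQuot (μ := μ)
  let a : Ξ × (𝔼 n) := (Classical.arbitrary Ξ, 0)
  induction K with
  | zero => simp [errSum]
  | succ k ih =>
    have hk : k < N := Nat.lt_of_succ_le hK
    let M : 𝓗 × (Fin k → Ξ × (𝔼 n)) → (𝔼 n) := fun z =>
      errSum F μ (meanQuot f μ (X z.1)) (X z.1) (extendSeq a z.2) k
    have hXz : Measurable fun z : 𝓗 × (Fin k → Ξ × (𝔼 n)) => X z.1 := hX.comp measurable_fst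
    have hM : Measurable M := measurable_errSum hF (hm.comp hXz) hXz
      ((measurable_extendSeq a k).comp measurable_snd) k
    have hMk : ∀ ω, errSum F μ (meanQuot f μ (X (A ω))) (X (A ω)) (fun j => (ξ j ω, u j ω)) k =
        M (pastSamples A ξ u k ω) :=
      fun ω => errSum_congr fun j hj => (extendSeq_of_lt a (pastSamples A ξ u k ω).2 hj).symm
    have hz : Measurable fun z : (𝓗 × (Fin k → Ξ × (𝔼 n))) × (Ξ × (𝔼 n)) =>
        diffQuot (fun y => F y z.2.1) μ (X z.1.1) z.2.2 :=
      measurable_diffQuot_comp hF (hX.comp measurable_fst.fst) measurable_snd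
    have hχ : Measurable fun z : 𝓗 × (Fin k → Ξ × (𝔼 n)) =>
        ENNReal.ofReal (momentBound f L σ μ (X z.1)) :=
      (hV.comp (hX.comp measurable_fst)).ennreal_ofReal
    have hmain := lintegral_comp_history_le (h.measurable_pastSamples k) (h.measurable_ξ k)
      (h.measurable_u k) (h.indep k hk)
      (ψ := fun z p => ENNReal.ofReal (‖M z + (diffQuot (fun y => F y p.1) μ (X z.1) p.2
        - meanQuot f μ (X z.1))‖ ^ 2))
      (χ := fun z => ENNReal.ofReal (‖M z‖ ^ 2) + ENNReal.ofReal (momentBound f L σ μ (X z.1)))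
      (((hM.comp measurable_fst).add (hz.sub
        (hm.comp (hX.comp measurable_fst.fst)))).norm.pow_const 2).ennreal_ofReal
      ((hM.norm.pow_const 2).ennreal_ofReal.add hχ)
      (by
        filter_upwards [h.oracle k hk] with z hQ
        rw [h.gaussian k hk]
        exact hQ.lintegral_norm_add_diffQuot_sq_le hF hμ (X z.1) (M z))
    have hχ' : Measurable fun ω => ENNReal.ofReal (momentBound f L σ μ (X (A ω))) :=
      (hV.comp (hX.comp h.measurable_init)).ennreal_ofReal
    simp only [pastSamples] at hmain
    rw [lintegral_add_right _ hχ'] at hmain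
    have ih' := ih hk.le
    simp only [hMk, pastSamples] at ih'
    have e : ∀ ω, errSum F μ (meanQuot f μ (X (A ω))) (X (A ω)) (fun j => (ξ j ω, u j ω)) (k + 1)
        = M (A ω, fun j => (ξ j ω, u j ω)) + (diffQuot (fun y => F y (ξ k ω)) μ (X (A ω)) (u k ω)
          - meanQuot f μ (X (A ω))) := by
      intro ω
      rw [errSum, Finset.sum_range_succ]
      congr 1
      exact hMk ω
    simp only [e]
    refine hmain.trans ((add_le_add ih' le_rfl).trans (le_of_eq ?_))
    push_cast
    ring

end IsOracleStream

end Stream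

/-! ### Stepsizes and the random iterate -/

section Stepsize

variable {n : ℕ} {L σ D : ℝ} {N : ℕ}

lemma stepsize_pos (hL : 0 < L) (hσ : 0 ≤ σ) (hD : 0 < D) (hN : 1 ≤ N) (k : ℕ) :
    0 < stepsize n L σ D N k := by
  have hN' : (0 : ℝ) < N := by exact_mod_cast hN
  unfold stepsize
  split_ifs with h
  · positivity
  · have : 0 < σ := lt_of_le_of_ne hσ (Ne.symm h)
    positivity

lemma stepsize_le (hL : 0 < L) (k : ℕ) :
    4 * L * (n + 4) * stepsize n L σ D N k ≤ 1 := by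
  have hs : 0 < √((n : ℝ) + 4) := by positivity
  have hs2 : √((n : ℝ) + 4) ^ 2 = n + 4 := Real.sq_sqrt (by positivity)
  have h : stepsize n L σ D N k ≤ 1 / √((n : ℝ) + 4) * (1 / (4 * L * √((n : ℝ) + 4))) := by
    unfold stepsize
    gcongr
    split_ifs
    · exact le_rfl
    · exact min_le_left _ _
  calc 4 * L * (n + 4) * stepsize n L σ D N k
      ≤ 4 * L * (n + 4) * (1 / √((n : ℝ) + 4) * (1 / (4 * L * √((n : ℝ) + 4)))) := by gcongr
    _ = 1 := by field_simp; exact hs2.symm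

lemma stepsize_mul_le (hσ : 0 ≤ σ) (hD : 0 < D) (hN : 1 ≤ N) (k : ℕ) :
    stepsize n L σ D N k * (σ * √((n : ℝ) + 4) * √(N : ℝ)) ≤ D := by
  have hN' : (0 : ℝ) < N := by exact_mod_cast hN
  have hs : 0 < √((n : ℝ) + 4) := by positivity
  rcases eq_or_ne σ 0 with h | h
  · simp [h, hD.le]
  · have hσ' : 0 < σ := lt_of_le_of_ne hσ (Ne.symm h)
    have h2 : stepsize n L σ D N k ≤ 1 / √((n : ℝ) + 4) * (D / (σ * √(N : ℝ))) := by
      unfold stepsize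
      rw [if_neg h]
      gcongr
      exact min_le_right _ _
    calc _ ≤ 1 / √((n : ℝ) + 4) * (D / (σ * √(N : ℝ))) * (σ * √((n : ℝ) + 4) * √(N : ℝ)) := by
          gcongr
      _ = D := by field_simp

/-- Whichever term attains the minimum in the stepsize makes one of the two summands equal to `1`.
This bounds `1/γ` from above by a sum. -/
lemma one_le_stepsize_mul (hL : 0 < L) (hσ : 0 ≤ σ) (hD : 0 < D) (hN : 1 ≤ N) (k : ℕ) :
    1 ≤ stepsize n L σ D N k * (4 * L * (n + 4) + σ * √((n : ℝ) + 4) * √(N : ℝ) / D) := by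
  have hN' : (0 : ℝ) < N := by exact_mod_cast hN
  have hs : 0 < √((n : ℝ) + 4) := by positivity
  have hs2 : √((n : ℝ) + 4) ^ 2 = n + 4 := Real.sq_sqrt (by positivity)
  have ht := stepsize_pos (n := n) hL hσ hD hN k
  have h1 : stepsize n L σ D N k = 1 / √((n : ℝ) + 4) * (1 / (4 * L * √((n : ℝ) + 4))) →
      1 = stepsize n L σ D N k * (4 * L * (n + 4)) := by
    intro h
    rw [h]
    field_simp
    exact hs2
  have h3 : 0 ≤ stepsize n L σ D N k * (4 * L * (n + 4)) := by positivity
  have h4 : 0 ≤ stepsize n L σ D N k * (σ * √((n : ℝ) + 4) * √(N : ℝ) / D) := by positivity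
  rw [mul_add]
  rcases eq_or_ne σ 0 with h | h
  · linarith [h1 (by unfold stepsize; rw [if_pos h])]
  · rcases min_choice (1 / (4 * L * √((n : ℝ) + 4))) (D / (σ * √(N : ℝ))) with hm | hm
    · linarith [h1 (by unfold stepsize; rw [if_neg h, hm])]
    · have : stepsize n L σ D N k = 1 / √((n : ℝ) + 4) * (D / (σ * √(N : ℝ))) := by
        unfold stepsize; rw [if_neg h, hm]
      have h5 : stepsize n L σ D N k * (σ * √((n : ℝ) + 4) * √(N : ℝ) / D) = 1 := by
        rw [this]
        field_simp
      linarith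

lemma half_stepsize_le (hL : 0 < L) (hσ : 0 ≤ σ) (hD : 0 < D) (hN : 1 ≤ N) (k : ℕ) :
    stepsize n L σ D N k / 2 ≤
      stepsize n L σ D N k - 2 * L * (n + 4) * stepsize n L σ D N k ^ 2 := by
  have h1 := stepsize_le (n := n) (σ := σ) (D := D) (N := N) hL k
  have h2 := stepsize_pos (n := n) hL hσ hD hN k
  nlinarith

/-- Constant stepsizes give equal weights, nonzero by `half_stepsize_le`. -/
lemma probR_stepsize (hL : 0 < L) (hσ : 0 ≤ σ) (hD : 0 < D) (hN : 1 ≤ N) (k : ℕ) :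
    probR n L (stepsize n L σ D N) N k = 1 / N := by
  have h1 := half_stepsize_le (n := n) hL hσ hD hN k
  have h2 := stepsize_pos (n := n) hL hσ hD hN k
  have h3 : ∀ j, stepsize n L σ D N j = stepsize n L σ D N k := fun _ => rfl
  have h4 : stepsize n L σ D N k - 2 * L * (n + 4) * stepsize n L σ D N k ^ 2 ≠ 0 := by linarith
  unfold probR
  simp_rw [h3]
  rw [Finset.sum_const, Nat.card_Icc, nsmul_eq_mul, Nat.add_sub_cancel, div_mul_cancel_right₀ h4,
    one_div]

/-- The budget of the descent argument is covered by `Bbar`. -/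
lemma descent_budget_le {μ Δ : ℝ} (hL : 0 < L) (hσ : 0 ≤ σ) (hD : 0 < D) (hN : 1 ≤ N)
    (hμ : μ ^ 2 * (2 * N * (n + 4) ^ 2) ≤ Δ ^ 2) (k : ℕ) :
    L * Δ ^ 2 / 2 + N * (stepsize n L σ D N k / 2 * biasBound n L μ ^ 2
        + L / 2 * stepsize n L σ D N k ^ 2
          * (2 * (n + 4) * σ ^ 2 + 15 / 2 * μ ^ 2 * L ^ 2 * n ^ 3))
      ≤ L * Bbar n L σ D Δ N * (N * ((stepsize n L σ D N k
        - 2 * L * (n + 4) * stepsize n L σ D N k ^ 2) / 2)) := by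
  have h1 := stepsize_le (n := n) (σ := σ) (D := D) (N := N) hL k
  have h2 := stepsize_pos (n := n) hL hσ hD hN k
  have h3 := half_stepsize_le (n := n) hL hσ hD hN k
  have h4 := stepsize_mul_le (n := n) (L := L) hσ hD hN k
  have h5 := one_le_stepsize_mul (n := n) hL hσ hD hN k
  set t := stepsize n L σ D N k
  have hN' : (0 : ℝ) < N := by exact_mod_cast hN
  have hr : 0 < √(N : ℝ) := by positivity
  have hr2 : √(N : ℝ) ^ 2 = N := Real.sq_sqrt (by positivity)
  have hs2 : √((n : ℝ) + 4) ^ 2 = n + 4 := Real.sq_sqrt (by positivity)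
  have hB0 : 0 ≤ Bbar n L σ D Δ N := by unfold Bbar; positivity
  set q := σ * √((n : ℝ) + 4) * √(N : ℝ) with hq
  have hq0 : 0 ≤ q := by positivity
  have hq2 : q ^ 2 = σ ^ 2 * (n + 4) * N := by rw [hq, mul_pow, mul_pow, hr2, hs2]
  have hR : L * Bbar n L σ D Δ N * (N * (t / 4)) ≤
      L * Bbar n L σ D Δ N * (N * ((t - 2 * L * (n + 4) * t ^ 2) / 2)) := by
    refine mul_le_mul_of_nonneg_left (mul_le_mul_of_nonneg_left ?_ hN'.le) (by positivity)
    linarith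
  refine le_trans ?_ hR
  -- With `X = t(n+4)L²Δ²` the available budget is `3X + tLqD + tLqΔ²/D`. The initial gap uses `2X`
  -- and the last term (`f1`), the noise uses `tLqD` (`f2`), and the smoothing errors use `(1/16 +
  -- 15/32)X` (`f3`, `f4`).
  have hB : L * Bbar n L σ D Δ N * (N * (t / 4)) =
      3 * (t * (n + 4) * L ^ 2 * Δ ^ 2) + t * L * q * D + t * L * q * (Δ ^ 2 / D) := by
    have e : 4 * σ * √((n : ℝ) + 4) / √(N : ℝ) * N = 4 * q := by
      rw [hq]; nth_rw 2 [← hr2]; field_simp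
    have e2 : 12 * ((n : ℝ) + 4) * L * Δ ^ 2 / N * N = 12 * ((n : ℝ) + 4) * L * Δ ^ 2 := by
      field_simp
    calc L * Bbar n L σ D Δ N * (N * (t / 4))
        = L * (t / 4) * (12 * ((n : ℝ) + 4) * L * Δ ^ 2 / N * N
          + (4 * σ * √((n : ℝ) + 4) / √(N : ℝ) * N) * (D + Δ ^ 2 / D)) := by unfold Bbar; ring
      _ = _ := by rw [e, e2]; ring
  rw [hB]
  have hn : (0 : ℝ) ≤ n := Nat.cast_nonneg n
  have f1 : L * Δ ^ 2 / 2 ≤ 2 * (t * (n + 4) * L ^ 2 * Δ ^ 2) + t * L * q * (Δ ^ 2 / D) := by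
    have h6 : 0 ≤ t * L * q * (Δ ^ 2 / D) := by positivity
    have h7 : L * Δ ^ 2 / 2 * 1 ≤ L * Δ ^ 2 / 2 * (t * (4 * L * (n + 4) + q / D)) := by gcongr
    have h8 : L * Δ ^ 2 / 2 * (t * (4 * L * (n + 4) + q / D)) =
        2 * (t * (n + 4) * L ^ 2 * Δ ^ 2) + t * L * q * (Δ ^ 2 / D) / 2 := by ring
    linarith
  have f2 : N * (L / 2 * t ^ 2 * (2 * (n + 4) * σ ^ 2)) ≤ t * L * q * D := by
    calc _ = t * L * q * (t * q) := by
          rw [show t * L * q * (t * q) = L * t ^ 2 * q ^ 2 by ring, hq2]; ring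
      _ ≤ _ := by gcongr
  have f3 : N * (t / 2 * biasBound n L μ ^ 2) ≤ 1 / 16 * (t * (n + 4) * L ^ 2 * Δ ^ 2) := by
    rw [biasBound_sq]
    have : (n : ℝ) ^ 2 * (n + 2) ≤ (n + 4) ^ 3 := by
      calc (n : ℝ) ^ 2 * (n + 2) ≤ (n + 4) ^ 2 * (n + 4) := by gcongr <;> linarith
        _ = _ := by ring
    calc N * (t / 2 * (μ ^ 2 * L ^ 2 / 4 * (n ^ 2 * (n + 2))))
        ≤ N * (t / 2 * (μ ^ 2 * L ^ 2 / 4 * (n + 4) ^ 3)) := by gcongr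
      _ = 1 / 16 * (t * (n + 4) * L ^ 2) * (μ ^ 2 * (2 * N * (n + 4) ^ 2)) := by ring
      _ ≤ 1 / 16 * (t * (n + 4) * L ^ 2) * Δ ^ 2 := by gcongr
      _ = _ := by ring
  have f4 : N * (L / 2 * t ^ 2 * (15 / 2 * μ ^ 2 * L ^ 2 * n ^ 3)) ≤
      15 / 32 * (t * (n + 4) * L ^ 2 * Δ ^ 2) := by
    have : (n : ℝ) ^ 3 ≤ (n + 4) ^ 3 := by gcongr; linarith
    calc N * (L / 2 * t ^ 2 * (15 / 2 * μ ^ 2 * L ^ 2 * n ^ 3))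
        ≤ N * (L / 2 * t ^ 2 * (15 / 2 * μ ^ 2 * L ^ 2 * (n + 4) ^ 3)) := by gcongr
      _ = 15 / 32 * (t * L ^ 2) * (4 * L * (n + 4) * t) * (μ ^ 2 * (2 * N * (n + 4) ^ 2)) := by
          ring
      _ ≤ 15 / 32 * (t * L ^ 2) * 1 * Δ ^ 2 := by gcongr
      _ ≤ 15 / 32 * (t * L ^ 2) * (n + 4) * Δ ^ 2 := by gcongr; linarith
      _ = _ := by ring
  have f5 : 0 ≤ t * (n + 4) * L ^ 2 * Δ ^ 2 := by positivity
  linarith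

end Stepsize

/-! ### The randomly chosen iterate -/

lemma lintegral_comp_nat_eq_sum {Ω : Type*} [MeasurableSpace Ω] {Pr : Measure Ω}
    {R : Ω → ℕ} (hR : Measurable R) {s : Finset ℕ}
    (hs : ∀ ω, R ω ∈ s) {Y : ℕ → Ω → ENNReal} (hY : ∀ k, Measurable (Y k)) :
    ∫⁻ ω, Y (R ω) ω ∂Pr = ∑ k ∈ s, ∫⁻ ω, (R ⁻¹' {k}).indicator 1 ω * Y k ω ∂Pr := by
  have hm : ∀ k, MeasurableSet (R ⁻¹' {k}) := fun k => hR (measurableSet_singleton k)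
  have hi : ∀ k, Measurable fun ω => (R ⁻¹' {k}).indicator 1 ω * Y k ω := fun k =>
    (measurable_one.indicator (hm k)).mul (hY k)
  rw [← lintegral_finsetSum _ fun k _ => hi k]
  congr with ω
  rw [Finset.sum_eq_single_of_mem (R ω) (hs ω)]
  · simp
  · intro k _ hk
    simp [Ne.symm hk]

section RandomIterate

variable {n : ℕ}

local notation "𝔼" n => EuclideanSpace ℝ (Fin n)

variable {Ω 𝓗 Ξ : Type*} [MeasurableSpace Ω] [MeasurableSpace 𝓗] [MeasurableSpace Ξ]
  [StandardBorelSpace Ξ] [Nonempty Ξ] {Pr : Measure Ω} [IsFiniteMeasure Pr] {A : Ω → 𝓗}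
  {ξ : ℕ → Ω → Ξ} {u : ℕ → Ω → (𝔼 n)} {F : (𝔼 n) → Ξ → ℝ} {f : (𝔼 n) → ℝ}
  {μ t L σ : ℝ} {x₁ : 𝔼 n} {N : ℕ}

lemma IsOracleStream.lintegral_gradient_random_le (h : IsOracleStream Pr A ξ u F f L σ N)
    (hF : Measurable (Function.uncurry F)) (hL : 0 < L) (hμ : 0 < μ) (hf : IsC11 L f) {fmin : ℝ}
    (ht : 0 ≤ t) (hmin : ∀ y, fmin ≤ f y) (hc : 0 < t - 2 * L * (n + 4) * t ^ 2)
    (hN : 1 ≤ N) {R : Ω → ℕ} (hR : Measurable R) (hRmem : ∀ ω, R ω ∈ Finset.Icc 1 N)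
    (hRlaw : ∀ k ∈ Finset.Icc 1 N, Pr.real {ω | R ω = k} = 1 / N)
    (hRind : IndepFun R (pastSamples A ξ u N) Pr) {B : ℝ}
    (hB : f x₁ - fmin + N * (t / 2 * biasBound n L μ ^ 2 +
        L / 2 * t ^ 2 * (2 * (n + 4) * σ ^ 2 + 15 / 2 * μ ^ 2 * L ^ 2 * n ^ 3))
      ≤ B * (N * ((t - 2 * L * (n + 4) * t ^ 2) / 2)))
    {w : 𝓗 → ENNReal} (hw : Measurable w) :
    ∫⁻ ω, w (A ω) * ENNReal.ofReal
        (‖gradient f (sgIter F μ t x₁ (fun j => (ξ j ω, u j ω)) (R ω - 1))‖ ^ 2) ∂Pr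
      ≤ ENNReal.ofReal B * ∫⁻ ω, w (A ω) ∂Pr := by
  set c := (t - 2 * L * (n + 4) * t ^ 2) / 2
  have hc0 : 0 < c := half_pos hc
  have hN' : (0 : ℝ) < N := by exact_mod_cast hN
  have hgc := hf.continuous_gradient hL.le
  let a : Ξ × (𝔼 n) := (Classical.arbitrary Ξ, 0)
  let Y : ℕ → Ω → ENNReal := fun k ω => w (A ω) * ENNReal.ofReal
        (‖gradient f (sgIter F μ t x₁ (fun j => (ξ j ω, u j ω)) k)‖ ^ 2)
  have hYm : ∀ k, Measurable (Y k) := fun k =>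
    (hw.comp h.measurable_init).mul ((hgc.measurable.comp
      ((measurable_sgIter hF k).comp h.measurable_samples)).norm.pow_const 2).ennreal_ofReal
  have hsum : ENNReal.ofReal c * ∑ k ∈ Finset.range N, ∫⁻ ω, Y k ω ∂Pr ≤
      ENNReal.ofReal (B * (N * c)) * ∫⁻ ω, w (A ω) ∂Pr := by
    -- The final objective gap is nonnegative and is discarded here.
    refine le_trans ?_ ((le_add_self.trans (h.sum_lintegral_gradient_le (x₁ := x₁) hF hL hμ hf ht
      hmin hc.le hw le_rfl)).trans (by gcongr))
    rw [Finset.mul_sum]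
    refine Finset.sum_le_sum fun k _ => ?_
    rw [← lintegral_const_mul _ (hYm k)]
    refine lintegral_mono fun ω => ?_
    simp only [Y]
    rw [ENNReal.ofReal_mul hc0.le]
    exact le_of_eq (by ring)
  have hterm : ∀ k ∈ Finset.Icc 1 N,
      ∫⁻ ω, (R ⁻¹' {k}).indicator 1 ω * Y (k - 1) ω ∂Pr =
        ENNReal.ofReal (1 / N) * ∫⁻ ω, Y (k - 1) ω ∂Pr := by
    intro k hk
    have hkN : k - 1 ≤ N := (Nat.sub_le k 1).trans (Finset.mem_Icc.1 hk).2
    let Z : 𝓗 × (Fin N → Ξ × (𝔼 n)) → ENNReal := fun z => w z.1 * ENNReal.ofReal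
        (‖gradient f (sgIter F μ t x₁ (extendSeq a z.2) (k - 1))‖ ^ 2)
    have hZ : Measurable Z := (hw.comp measurable_fst).mul ((hgc.measurable.comp
      ((measurable_sgIter hF (k - 1)).comp
        ((measurable_extendSeq a N).comp measurable_snd))).norm.pow_const 2).ennreal_ofReal
    have hYZ : Y (k - 1) = Z ∘ pastSamples A ξ u N := by
      ext ω
      simp only [Y, Z, Function.comp_apply, pastSamples]
      rw [sgIter_congr fun j hj => (extendSeq_of_lt a (pastSamples A ξ u N ω).2
        (hj.trans_le hkN)).symm]
      rfl
    -- `R` is independent of `A` and the samples jointly, so the weight `w (A ω)` may stay inside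
    -- `Y`.
    have hind : IndepFun ((R ⁻¹' {k}).indicator (1 : Ω → ENNReal)) (Y (k - 1)) Pr := by
      rw [hYZ]
      exact hRind.comp (φ := ({k} : Set ℕ).indicator 1) (measurable_of_countable _) hZ
    rw [lintegral_mul_eq_lintegral_mul_lintegral_of_indepFun''
      (measurable_one.indicator (hR (measurableSet_singleton k))).aemeasurable
      (hYm _).aemeasurable hind, lintegral_indicator_one (hR (measurableSet_singleton k))]
    congr 1
    rw [← hRlaw k hk, ofReal_measureReal]
    rfl
  calc ∫⁻ ω, Y (R ω - 1) ω ∂Pr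
      = ∑ k ∈ Finset.Icc 1 N, ∫⁻ ω, (R ⁻¹' {k}).indicator 1 ω * Y (k - 1) ω ∂Pr :=
        lintegral_comp_nat_eq_sum (Y := fun k => Y (k - 1)) hR hRmem fun k => hYm _
    _ = ENNReal.ofReal (1 / N) * ∑ k ∈ Finset.range N, ∫⁻ ω, Y k ω ∂Pr := by
        have e : Finset.Icc 1 N = Finset.Ico 1 (N + 1) := by ext k; simp
        rw [Finset.sum_congr rfl hterm, ← Finset.mul_sum, e, Finset.sum_Ico_eq_sum_range]
        simp
    _ = ENNReal.ofReal (1 / (N * c)) *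
          (ENNReal.ofReal c * ∑ k ∈ Finset.range N, ∫⁻ ω, Y k ω ∂Pr) := by
        rw [← mul_assoc, ← ENNReal.ofReal_mul (by positivity)]
        congr 2
        field_simp
    _ ≤ ENNReal.ofReal (1 / (N * c)) *
          (ENNReal.ofReal (B * (N * c)) * ∫⁻ ω, w (A ω) ∂Pr) := by gcongr
    _ = _ := by
        rw [← mul_assoc, ← ENNReal.ofReal_mul (by positivity)]
        congr 2
        field_simp

end RandomIterate

/-! ### Outputs and numbers of oracle calls -/

section Program

namespace OracleProg

variable {E Ξ α β : Type*} (F : E → Ξ → ℝ)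

lemma output_bind (p : OracleProg E Ξ α) (g : α → OracleProg E Ξ β) :
    (p.bind g).output F = (g (p.output F)).output F := by
  induction p with
  | ret a => rfl
  | ask x ξ next ih => exact ih _

lemma calls_bind (p : OracleProg E Ξ α) (g : α → OracleProg E Ξ β) :
    (p.bind g).calls F = p.calls F + (g (p.output F)).calls F := by
  induction p with
  | ret a => simp [bind, calls, output]
  | ask x ξ next ih =>
    have := ih (F x ξ)
    simp only [bind, calls, output]
    omega

lemma output_collect (m : ℕ) (p : Fin m → OracleProg E Ξ α) :
    (collect m p).output F = fun i => (p i).output F := by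
  induction m with
  | zero => ext i; exact i.elim0
  | succ m ih =>
    simp only [collect, output_bind, ih]
    ext i
    refine Fin.cases ?_ (fun j => ?_) i <;> simp [output]

lemma calls_collect_le {m : ℕ} {p : Fin m → OracleProg E Ξ α} {c : ℕ}
    (h : ∀ i, (p i).calls F ≤ c) : (collect m p).calls F ≤ m * c := by
  induction m with
  | zero => simp [collect, calls]
  | succ m ih =>
    simp only [collect, calls_bind, calls]
    have h1 := ih fun i => h i.succ
    have h2 := h 0
    rw [Nat.succ_mul]
    omega

end OracleProg

variable {n : ℕ}

local notation "𝔼" n => EuclideanSpace ℝ (Fin n)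

variable {Ξ Ω : Type*} (F : (𝔼 n) → Ξ → ℝ) (γ : ℕ → ℝ) (μ t : ℝ) (x₁ x : 𝔼 n)
  (ξ : ℕ → Ξ) (u : ℕ → (𝔼 n))

open OracleProg

lemma output_gradEstimate (ξ : Ξ) (u : 𝔼 n) :
    (gradEstimate μ x ξ u).output F = diffQuot (fun y => F y ξ) μ x u := rfl

lemma calls_gradEstimate (ξ : Ξ) (u : 𝔼 n) : (gradEstimate μ x ξ u).calls F = 2 := rfl

lemma output_rsgfSteps (hγ : ∀ k, γ k = t) (k : ℕ) :
    (rsgfSteps γ μ x₁ ξ u k).output F = sgIter F μ t x₁ (fun j => (ξ j, u j)) k := by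
  induction k with
  | zero => rfl
  | succ k ih =>
    simp only [rsgfSteps, output_bind, ih, output_gradEstimate, output, hγ, sgIter]

lemma calls_rsgfSteps (k : ℕ) : (rsgfSteps γ μ x₁ ξ u k).calls F = 2 * k := by
  induction k with
  | zero => rfl
  | succ k ih =>
    simp only [rsgfSteps, calls_bind, ih, calls_gradEstimate, calls]
    ring

/-- `sgIter` is numbered from `0`, so `x_R` has index `R - 1`; the last call of the estimator
affects only the cost. -/
lemma output_rsgf (hγ : ∀ k, γ k = t) (R : ℕ) :
    (rsgf γ μ x₁ ξ u R).output F = sgIter F μ t x₁ (fun j => (ξ j, u j)) (R - 1) := by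
  simp only [rsgf, output_bind, output_rsgfSteps F γ μ t x₁ ξ u hγ, output]

lemma calls_rsgf {R : ℕ} (hR : 1 ≤ R) : (rsgf γ μ x₁ ξ u R).calls F = 2 * R := by
  simp only [rsgf, calls_bind, calls_rsgfSteps, calls_gradEstimate, calls]
  omega

lemma output_avgGradEstimate (T : ℕ) :
    (avgGradEstimate μ T x ξ u).output F =
      (1 / (T : ℝ)) • ∑ k ∈ Finset.range T, diffQuot (fun y => F y (ξ k)) μ x (u k) := by
  simp only [avgGradEstimate, output_bind, output_collect, output_gradEstimate, output]
  rw [Finset.sum_range]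

lemma calls_avgGradEstimate_le (T : ℕ) : (avgGradEstimate μ T x ξ u).calls F ≤ T * 2 := by
  simp only [avgGradEstimate, calls_bind, calls]
  exact calls_collect_le F fun i => (calls_gradEstimate F μ x _ _).le

lemma calls_twoRSGF_le (S T N : ℕ) (d : Draws n Ξ Ω) (ω : Ω)
    (pick : (Fin S → (𝔼 n)) → Fin S) (hR : ∀ s < S, d.R s ω ∈ Finset.Icc 1 N) :
    (twoRSGF γ μ x₁ S T d ω pick).calls F ≤ 2 * S * (N + T) := by
  simp only [twoRSGF, calls_bind, calls]
  have h1 : (collect S fun s : Fin S =>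
      rsgf γ μ x₁ (fun k => d.ξ s k ω) (fun k => d.u s k ω) (d.R s ω)).calls F ≤ S * (2 * N) := by
    refine calls_collect_le F fun s => ?_
    have := Finset.mem_Icc.1 (hR s s.2)
    rw [calls_rsgf F γ μ x₁ _ _ this.1]
    omega
  have h2 := fun x : Fin S → (𝔼 n) => calls_collect_le F (m := S) fun s =>
    calls_avgGradEstimate_le F μ (x s) (fun k => d.ξ' s k ω) (fun k => d.u' s k ω) T
  refine (add_le_add h1 (add_le_add (h2 _) le_rfl)).trans (le_of_eq ?_)
  ring

/-- The output of run `s` of the optimization phase. -/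
noncomputable def candidate (d : Draws n Ξ Ω) (s : ℕ) (ω : Ω) : 𝔼 n :=
  sgIter F μ t x₁ (fun j => (d.ξ s j ω, d.u s j ω)) (d.R s ω - 1)

/-- The averaged gradient estimate at candidate `s`. -/
noncomputable def candidateEstimate (T : ℕ) (d : Draws n Ξ Ω) (s : ℕ) (ω : Ω) : 𝔼 n :=
  (1 / (T : ℝ)) • ∑ k ∈ Finset.range T,
    diffQuot (fun y => F y (d.ξ' s k ω)) μ (candidate F μ t x₁ d s ω) (d.u' s k ω)

lemma output_twoRSGF (hγ : ∀ k, γ k = t) (S T : ℕ) (d : Draws n Ξ Ω) (ω : Ω)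
    (pick : (Fin S → (𝔼 n)) → Fin S) :
    (twoRSGF γ μ x₁ S T d ω pick).output F =
      candidate F μ t x₁ d (pick fun s => candidateEstimate F μ t x₁ T d s ω) ω := by
  simp only [twoRSGF, output_bind, output_collect, output, output_rsgf F γ μ t x₁ _ _ hγ,
    output_avgGradEstimate]
  rfl

end Program

/-! ### The two phases -/

section TwoPhases

variable {n : ℕ}

local notation "𝔼" n => EuclideanSpace ℝ (Fin n)

variable {Ω Ξ : Type*} [MeasurableSpace Ω] [MeasurableSpace Ξ] [Nonempty Ξ]
  {F : (𝔼 n) → Ξ → ℝ} {f : (𝔼 n) → ℝ} {μ t L σ D : ℝ} {x₁ : 𝔼 n} {S N T : ℕ} {γ : ℕ → ℝ}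
  {d : Draws n Ξ Ω}

/-- The output of a run as a function of its samples and of its iteration count. -/
noncomputable def runOutput (F : (𝔼 n) → Ξ → ℝ) (μ t : ℝ) (x₁ : 𝔼 n) {N : ℕ}
    (q : (Fin N → Ξ × (𝔼 n)) × ℕ) : 𝔼 n :=
  sgIter F μ t x₁ (extendSeq (Classical.arbitrary Ξ, 0) q.1) (q.2 - 1)

/-- The iteration count is countably valued, so it may be fixed. -/
lemma measurable_runOutput (hF : Measurable (Function.uncurry F)) :
    Measurable (runOutput F μ t x₁ : (Fin N → Ξ × (𝔼 n)) × ℕ → (𝔼 n)) :=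
  measurable_from_prod_countable_left fun r =>
    (measurable_sgIter hF (r - 1)).comp (measurable_extendSeq _ N)

variable [StandardBorelSpace Ξ] {Pr : Measure Ω} [IsProbabilityMeasure Pr]

namespace Draws.IsSampling

lemma measurable_runsBefore (h : d.IsSampling Pr F f L σ γ S N T) (s : ℕ) :
    Measurable (d.runsBefore N s) := by
  refine measurable_pi_iff.2 fun q => Measurable.prodMk (measurable_pi_iff.2 fun j => ?_) ?_
  · exact (h.measurable_ξ q j).prodMk (h.measurable_u q j)
  · exact h.measurable_R q

lemma isOracleStream (h : d.IsSampling Pr F f L σ γ S N T) {s : ℕ} (hs : s < S) :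
    IsOracleStream Pr (d.runsBefore N s) (d.ξ s) (d.u s) F f L σ N where
  measurable_init := h.measurable_runsBefore s
  measurable_ξ := h.measurable_ξ s
  measurable_u := h.measurable_u s
  oracle := h.oracle s hs
  gaussian := h.gaussian s hs
  indep := h.gaussian_indep s hs

lemma isOracleStream' (h : d.IsSampling Pr F f L σ γ S N T) {s : ℕ} (hs : s < S) :
    IsOracleStream Pr (d.runsBefore N S) (d.ξ' s) (d.u' s) F f L σ T where
  measurable_init := h.measurable_runsBefore S
  measurable_ξ := h.measurable_ξ' s
  measurable_u := h.measurable_u' s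
  oracle := h.oracle' s hs
  gaussian := h.gaussian' s hs
  indep := h.gaussian_indep' s hs

/-- Since `R ≤ N`, the output reads only samples recorded in the history, never the padding. -/
lemma candidate_eq (h : d.IsSampling Pr F f L σ γ S N T) {K : ℕ} (hK : K ≤ S) (q : Fin K)
    (ω : Ω) : candidate F μ t x₁ d q ω = runOutput F μ t x₁ (d.runsBefore N K ω q) := by
  have hR := Finset.mem_Icc.1 (h.R_mem q (q.2.trans_le hK) ω)
  refine sgIter_congr fun j hj => ?_
  have hjN : j < N := by omega
  exact (extendSeq_of_lt _ (d.runsBefore N K ω q).1 hjN).symm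

lemma measurable_candidate (h : d.IsSampling Pr F f L σ γ S N T)
    (hF : Measurable (Function.uncurry F)) {s : ℕ} (hs : s < S) :
    Measurable (candidate F μ t x₁ d s) := by
  have e : candidate F μ t x₁ d s = fun ω => runOutput F μ t x₁ (d.runsBefore N S ω ⟨s, hs⟩) :=
    funext fun ω => h.candidate_eq le_rfl ⟨s, hs⟩ ω
  rw [e]
  exact (measurable_runOutput hF).comp
    ((measurable_pi_apply _).comp (h.measurable_runsBefore S))

/-- The mean square of the gradient at a candidate, conditionally on the previous runs. -/
lemma lintegral_candidate_le (h : d.IsSampling Pr F f L σ (stepsize n L σ D N) S N T)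
    (hF : Measurable (Function.uncurry F)) (hL : 0 < L) (hσ : 0 ≤ σ) (hD : 0 < D) (hN : 1 ≤ N)
    (hμ : 0 < μ) (hf : IsC11 L f) {fmin Δ : ℝ} (hmin : ∀ y, fmin ≤ f y)
    (hΔ : L * Δ ^ 2 / 2 = f x₁ - fmin) (hμΔ : μ ^ 2 * (2 * N * (n + 4) ^ 2) ≤ Δ ^ 2)
    (ht : ∀ k, stepsize n L σ D N k = t) {s : ℕ} (hs : s < S)
    {w : (Fin s → (Fin N → Ξ × (𝔼 n)) × ℕ) → ENNReal} (hw : Measurable w) :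
    ∫⁻ ω, w (d.runsBefore N s ω) * ENNReal.ofReal
        (‖gradient f (candidate F μ t x₁ d s ω)‖ ^ 2) ∂Pr
      ≤ ENNReal.ofReal (L * Bbar n L σ D Δ N) * ∫⁻ ω, w (d.runsBefore N s ω) ∂Pr := by
  have h0 : 0 < t := ht 0 ▸ stepsize_pos hL hσ hD hN 0
  have h1 := half_stepsize_le (n := n) hL hσ hD hN 0
  have h2 := descent_budget_le (n := n) hL hσ hD hN hμΔ 0
  rw [ht] at h1 h2
  rw [hΔ] at h2
  exact (h.isOracleStream hs).lintegral_gradient_random_le hF hL hμ hf h0.le hmin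
    (by linarith) hN (h.measurable_R s) (h.R_mem s hs)
    (fun k hk => (h.R_law s hs k hk).trans (probR_stepsize hL hσ hD hN k)) (h.R_indep s hs) h2 hw

/-- The probability that all candidates have a large gradient. -/
lemma measure_forall_candidate_le (h : d.IsSampling Pr F f L σ (stepsize n L σ D N) S N T)
    (hF : Measurable (Function.uncurry F)) (hL : 0 < L) (hσ : 0 ≤ σ) (hD : 0 < D) (hN : 1 ≤ N)
    (hμ : 0 < μ) (hf : IsC11 L f) {fmin Δ : ℝ} (hmin : ∀ y, fmin ≤ f y)
    (hΔ : L * Δ ^ 2 / 2 = f x₁ - fmin) (hμΔ : μ ^ 2 * (2 * N * (n + 4) ^ 2) ≤ Δ ^ 2)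
    (hB : 0 < L * Bbar n L σ D Δ N)
    (ht : ∀ k, stepsize n L σ D N k = t) {K : ℕ} (hK : K ≤ S) :
    Pr {ω | ∀ q < K, 2 * (L * Bbar n L σ D Δ N) ≤
      ‖gradient f (candidate F μ t x₁ d q ω)‖ ^ 2} ≤ 2⁻¹ ^ K := by
  set B := L * Bbar n L σ D Δ N
  have hgc := hf.continuous_gradient hL.le
  induction K with
  | zero => simp
  | succ s ih =>
    have hs : s < S := hK
    let C : Set (Fin s → (Fin N → Ξ × (𝔼 n)) × ℕ) :=
      {z | ∀ q, 2 * B ≤ ‖gradient f (runOutput F μ t x₁ (z q))‖ ^ 2}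
    have hC : MeasurableSet C := by
      refine measurableSet_setOfPred.2 (Measurable.forall fun q => ?_)
      refine measurableSet_setOfPred.1 (measurableSet_le measurable_const ?_)
      exact ((hgc.measurable.comp ((measurable_runOutput hF).comp
        (measurable_pi_apply q))).norm.pow_const 2)
    have hAC : {ω | ∀ q < s, 2 * B ≤ ‖gradient f (candidate F μ t x₁ d q ω)‖ ^ 2} =
        d.runsBefore N s ⁻¹' C := by
      ext ω
      simp only [Set.mem_ofPred_eq, Set.mem_preimage, C]
      constructor
      · intro hq q
        rw [← h.candidate_eq hs.le q ω]
        exact hq q q.2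
      · intro hq q hqs
        rw [h.candidate_eq hs.le ⟨q, hqs⟩ ω]
        exact hq ⟨q, hqs⟩
    have hrb := h.measurable_runsBefore s
    -- The weight marks the event that the first `s` runs all failed. Markov's inequality gives `2B
    -- · P(s+1 failures) ≤ B · P(s failures)`, so each run halves the probability.
    let w : (Fin s → (Fin N → Ξ × (𝔼 n)) × ℕ) → ENNReal := C.indicator 1
    have hw : Measurable w := measurable_one.indicator hC
    have hmain := h.lintegral_candidate_le hF hL hσ hD hN hμ hf hmin hΔ hμΔ ht hs hw
    have hone : ∫⁻ ω, w (d.runsBefore N s ω) ∂Pr =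
        Pr (d.runsBefore N s ⁻¹' C) := by
      rw [← lintegral_indicator_one (hrb hC)]
      rfl
    rw [hone, ← hAC] at hmain
    have hm : Measurable fun ω => w (d.runsBefore N s ω) *
        ENNReal.ofReal (‖gradient f (candidate F μ t x₁ d s ω)‖ ^ 2) := by
      exact (hw.comp hrb).mul ((hgc.measurable.comp
        (h.measurable_candidate hF hs)).norm.pow_const 2).ennreal_ofReal
    have hmarkov := (mul_meas_ge_le_lintegral₀ hm.aemeasurable (ENNReal.ofReal (2 * B))).trans hmain
    have hsub : Pr {ω | ∀ q < s + 1, 2 * B ≤ ‖gradient f (candidate F μ t x₁ d q ω)‖ ^ 2} ≤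
        Pr {ω | ENNReal.ofReal (2 * B) ≤ w (d.runsBefore N s ω) *
          ENNReal.ofReal (‖gradient f (candidate F μ t x₁ d s ω)‖ ^ 2)} := by
      refine measure_mono fun ω hω => ?_
      have h1 : d.runsBefore N s ω ∈ C := by
        change ω ∈ d.runsBefore N s ⁻¹' C
        rw [← hAC]
        exact fun q hq => hω q (hq.trans s.lt_succ_self)
      simp only [w, Set.mem_ofPred_eq, Set.indicator_of_mem h1, Pi.one_apply, one_mul]
      exact ENNReal.ofReal_le_ofReal (hω s s.lt_succ_self)
    have hB0 : ENNReal.ofReal B ≠ 0 := by simpa using hB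
    have h3 : ENNReal.ofReal B * (2 * Pr {ω | ∀ q < s + 1, 2 * B ≤
        ‖gradient f (candidate F μ t x₁ d q ω)‖ ^ 2}) ≤ ENNReal.ofReal B * 2⁻¹ ^ s := by
      calc _ = ENNReal.ofReal (2 * B) * Pr {ω | ∀ q < s + 1, 2 * B ≤
            ‖gradient f (candidate F μ t x₁ d q ω)‖ ^ 2} := by
            rw [ENNReal.ofReal_mul zero_le_two, ENNReal.ofReal_ofNat]; ring
        _ ≤ _ := (mul_le_mul_right hsub _).trans (hmarkov.trans
            (mul_le_mul_right (ih hs.le) _))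
    have h4 := (ENNReal.mul_le_mul_iff_right hB0 ENNReal.ofReal_ne_top).1 h3
    rw [mul_comm] at h4
    rw [pow_succ, ← div_eq_mul_inv]
    exact (ENNReal.le_div_iff_mul_le (by simp) (by simp)).2 h4

/-- The probability of a large error in the estimate at a candidate. -/
lemma measure_estimate_error_le (h : d.IsSampling Pr F f L σ (stepsize n L σ D N) S N T)
    (hF : Measurable (Function.uncurry F)) (hL : 0 < L) (hσ : 0 ≤ σ) (hD : 0 < D) (hN : 1 ≤ N)
    (hT : 1 ≤ T)
    (hμ : 0 < μ) (hf : IsC11 L f) {fmin Δ : ℝ} (hmin : ∀ y, fmin ≤ f y)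
    (hΔ : L * Δ ^ 2 / 2 = f x₁ - fmin) (hμΔ : μ ^ 2 * (2 * N * (n + 4) ^ 2) ≤ Δ ^ 2)
    (hB : 0 < L * Bbar n L σ D Δ N)
    (ht : ∀ k, stepsize n L σ D N k = t) {s : ℕ} (hs : s < S) {c : ℝ} (hc : 0 < c) :
    Pr {ω | c ≤ ‖candidateEstimate F μ t x₁ T d s ω
        - meanQuot f μ (candidate F μ t x₁ d s ω)‖} ≤
      ENNReal.ofReal ((2 * (n + 2) * (L * Bbar n L σ D Δ N + σ ^ 2)
        + 15 / 2 * μ ^ 2 * L ^ 2 * n ^ 3) / (T * c ^ 2)) := by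
  set B := L * Bbar n L σ D Δ N
  have hT' : (0 : ℝ) < T := by exact_mod_cast hT
  have hgc := hf.continuous_gradient hL.le
  let X : (Fin S → (Fin N → Ξ × (𝔼 n)) × ℕ) → (𝔼 n) := fun z => runOutput F μ t x₁ (z ⟨s, hs⟩)
  have hX : Measurable X := (measurable_runOutput hF).comp (measurable_pi_apply _)
  have hXs : ∀ ω, candidate F μ t x₁ d s ω = X (d.runsBefore N S ω) := fun ω =>
    h.candidate_eq le_rfl ⟨s, hs⟩ ω
  have hst := h.isOracleStream' hs
  have hXm : Measurable fun ω => X (d.runsBefore N S ω) := hX.comp hst.measurable_init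
  have hgrad : ∫⁻ ω, ENNReal.ofReal (‖gradient f (X (d.runsBefore N S ω))‖ ^ 2) ∂Pr ≤
      ENNReal.ofReal B := by
    -- Weight `1` yields the unconditional mean square.
    have := h.lintegral_candidate_le hF hL hσ hD hN hμ hf hmin hΔ hμΔ ht hs
      (w := fun _ => 1) measurable_const
    simpa [hXs] using this
  have hgm : Measurable fun ω => ENNReal.ofReal (‖gradient f (X (d.runsBefore N S ω))‖ ^ 2) :=
    ((hgc.measurable.comp hXm).norm.pow_const 2).ennreal_ofReal
  have hmom : ∫⁻ ω, ENNReal.ofReal (momentBound f L σ μ (X (d.runsBefore N S ω))) ∂Pr ≤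
      ENNReal.ofReal (2 * (n + 2) * (B + σ ^ 2) + 15 / 2 * μ ^ 2 * L ^ 2 * n ^ 3) := by
    have e : ∀ x : 𝔼 n, ENNReal.ofReal (momentBound f L σ μ x) =
        ENNReal.ofReal (2 * (n + 2)) * ENNReal.ofReal (‖gradient f x‖ ^ 2)
          + ENNReal.ofReal (2 * (n + 2) * σ ^ 2 + 15 / 2 * μ ^ 2 * L ^ 2 * n ^ 3) := by
      intro x
      rw [← ENNReal.ofReal_mul (by positivity), ← ENNReal.ofReal_add (by positivity)
        (by positivity), momentBound]
      congr 1
      ring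
    simp_rw [e]
    rw [lintegral_add_right _ measurable_const, lintegral_const_mul _ hgm, lintegral_const,
      measure_univ, mul_one]
    refine (add_le_add (mul_le_mul_right hgrad _) le_rfl).trans ?_
    rw [← ENNReal.ofReal_mul (by positivity), ← ENNReal.ofReal_add (by positivity)
        (by positivity)]
    apply le_of_eq
    congr 1
    ring
  have herr := (hst.lintegral_errSum_le hF hμ hL hf hX le_rfl).trans
    (mul_le_mul_right hmom _)
  have hest : ∀ ω, errSum F μ (meanQuot f μ (X (d.runsBefore N S ω))) (X (d.runsBefore N S ω))
      (fun j => (d.ξ' s j ω, d.u' s j ω)) T =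
      (T : ℝ) • (candidateEstimate F μ t x₁ T d s ω
        - meanQuot f μ (candidate F μ t x₁ d s ω)) := by
    intro ω
    rw [errSum, Finset.sum_sub_distrib, candidateEstimate, smul_sub, smul_smul,
      mul_one_div_cancel hT'.ne', one_smul, hXs]
    simp [Nat.cast_smul_eq_nsmul]
  have hm : Measurable fun ω => ENNReal.ofReal (‖errSum F μ
      (meanQuot f μ (X (d.runsBefore N S ω))) (X (d.runsBefore N S ω))
      (fun j => (d.ξ' s j ω, d.u' s j ω)) T‖ ^ 2) :=
    ((measurable_errSum hF (hf.measurable_meanQuot.comp hXm) hXm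
      hst.measurable_samples T).norm.pow_const 2).ennreal_ofReal
  -- The sum is `T` times the averaged error, hence the level `(Tc)²`; its second moment is only
  -- linear in `T`, which leaves `1/(Tc²)`.
  have hmarkov := (mul_meas_ge_le_lintegral₀ hm.aemeasurable
    (ENNReal.ofReal ((T * c) ^ 2))).trans herr
  have hsub : Pr {ω | c ≤ ‖candidateEstimate F μ t x₁ T d s ω
        - meanQuot f μ (candidate F μ t x₁ d s ω)‖} ≤
      Pr {ω | ENNReal.ofReal ((T * c) ^ 2) ≤ ENNReal.ofReal (‖errSum F μ
      (meanQuot f μ (X (d.runsBefore N S ω))) (X (d.runsBefore N S ω))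
      (fun j => (d.ξ' s j ω, d.u' s j ω)) T‖ ^ 2)} := by
    refine measure_mono fun ω hω => ENNReal.ofReal_le_ofReal ?_
    rw [hest, norm_smul, Real.norm_of_nonneg hT'.le]
    have : c ≤ _ := hω
    gcongr
  have hTc : 0 < (T * c) ^ 2 := by positivity
  have h5 := (mul_le_mul_right hsub _).trans hmarkov
  rw [mul_comm, ← ENNReal.ofReal_natCast, ← ENNReal.ofReal_mul hT'.le] at h5
  refine ((ENNReal.le_div_iff_mul_le (Or.inl (by simpa using hTc.ne'))
    (Or.inl ENNReal.ofReal_ne_top)).2 h5).trans (le_of_eq ?_)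
  rw [← ENNReal.ofReal_div_of_pos hTc]
  congr 1
  field_simp

/-- A deterministic comparison off the event that all candidates are bad or some estimate is
inaccurate, followed by a union bound. The bias enters the threshold and costs no probability. -/
lemma measureReal_output_le (h : d.IsSampling Pr F f L σ (stepsize n L σ D N) S N T)
    (hF : Measurable (Function.uncurry F)) (hL : 0 < L) (hσ : 0 ≤ σ) (hD : 0 < D) (hN : 1 ≤ N)
    (hT : 1 ≤ T) (hμ : 0 < μ) (hf : IsC11 L f) {fmin Δ : ℝ} (hmin : ∀ y, fmin ≤ f y)
    (hΔ : L * Δ ^ 2 / 2 = f x₁ - fmin) (hμΔ : μ ^ 2 * (2 * N * (n + 4) ^ 2) ≤ Δ ^ 2)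
    (hB : 0 < L * Bbar n L σ D Δ N) {pick : Ω → (Fin S → (𝔼 n)) → Fin S}
    (hpick : ∀ ω (g : Fin S → (𝔼 n)) s, ‖g (pick ω g)‖ ≤ ‖g s‖) {c : ℝ} (hc : 0 < c) :
    Pr.real {ω | √(2 * (L * Bbar n L σ D Δ N)) + 2 * (c + biasBound n L μ) ≤
      ‖gradient f ((twoRSGF (stepsize n L σ D N) μ x₁ S T d ω (pick ω)).output F)‖} ≤
      2 ^ (-(S : ℝ)) + S * ((2 * (n + 2) * (L * Bbar n L σ D Δ N + σ ^ 2)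
        + 15 / 2 * μ ^ 2 * L ^ 2 * n ^ 3) / (T * c ^ 2)) := by
  set B := L * Bbar n L σ D Δ N
  set b := biasBound n L μ
  set V := 2 * (n + 2) * (B + σ ^ 2) + 15 / 2 * μ ^ 2 * L ^ 2 * n ^ 3
  obtain ⟨t, ht⟩ : ∃ t, ∀ k, stepsize n L σ D N k = t := ⟨stepsize n L σ D N 0, fun _ => rfl⟩
  have hV : 0 ≤ V / (T * c ^ 2) := by positivity
  have h2 : (2 : ℝ) ^ (-(S : ℝ)) = (2⁻¹) ^ S := by
    rw [Real.rpow_neg zero_le_two, Real.rpow_natCast, inv_pow]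
  refine ENNReal.toReal_le_of_le_ofReal (by positivity) ?_
  let A : Set Ω := {ω | ∀ q < S, 2 * B ≤ ‖gradient f (candidate F μ t x₁ d q ω)‖ ^ 2}
  let U : Fin S → Set Ω := fun s => {ω | c ≤ ‖candidateEstimate F μ t x₁ T d s ω
        - meanQuot f μ (candidate F μ t x₁ d s ω)‖}
  have hsub : {ω | √(2 * B) + 2 * (c + b) ≤
      ‖gradient f ((twoRSGF (stepsize n L σ D N) μ x₁ S T d ω (pick ω)).output F)‖} ⊆
      A ∪ ⋃ s, U s := by
    intro ω hω
    by_contra hcon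
    rw [Set.mem_union, Set.mem_iUnion, not_or, not_exists] at hcon
    obtain ⟨hA, hU⟩ := hcon
    simp only [A, Set.mem_ofPred_eq, not_forall, not_le] at hA
    obtain ⟨s, hs, hsB⟩ := hA
    have hU' : ∀ s : Fin S, ‖candidateEstimate F μ t x₁ T d s ω
        - gradient f (candidate F μ t x₁ d s ω)‖ < c + b := by
      intro s
      have h3 : ‖candidateEstimate F μ t x₁ T d s ω
        - meanQuot f μ (candidate F μ t x₁ d s ω)‖ < c := not_le.1 (hU s)
      have h4 := hf.norm_meanQuot_sub_le hL hμ (candidate F μ t x₁ d s ω)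
      have h5 := norm_sub_le_norm_sub_add_norm_sub (candidateEstimate F μ t x₁ T d s ω)
        (meanQuot f μ (candidate F μ t x₁ d s ω)) (gradient f (candidate F μ t x₁ d s ω))
      linarith
    have hω' : √(2 * B) + 2 * (c + b) ≤ ‖gradient f
        ((twoRSGF (stepsize n L σ D N) μ x₁ S T d ω (pick ω)).output F)‖ := hω
    rw [output_twoRSGF F _ μ t x₁ ht] at hω'
    set g : Fin S → (𝔼 n) := fun s => candidateEstimate F μ t x₁ T d s ω
    have h6 := hU' (pick ω g)
    have h7 := hU' ⟨s, hs⟩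
    have h8 : ‖g (pick ω g)‖ ≤ ‖g ⟨s, hs⟩‖ := hpick ω g ⟨s, hs⟩
    have h9 : ‖gradient f (candidate F μ t x₁ d s ω)‖ < √(2 * B) := Real.lt_sqrt_of_sq_lt hsB
    have h10 := norm_le_norm_add_norm_sub' (gradient f (candidate F μ t x₁ d (pick ω g) ω))
      (g (pick ω g))
    have h11 := norm_le_norm_add_norm_sub' (g ⟨s, hs⟩) (gradient f (candidate F μ t x₁ d s ω))
    rw [norm_sub_rev] at h10
    change ‖g (pick ω g) - _‖ < _ at h6
    change ‖g ⟨s, hs⟩ - gradient f (candidate F μ t x₁ d s ω)‖ < _ at h7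
    linarith
  calc _ ≤ Pr A + ∑ s, Pr (U s) := (measure_mono hsub).trans ((measure_union_le _ _).trans
        (add_le_add le_rfl (measure_iUnion_fintype_le _ _)))
    _ ≤ 2⁻¹ ^ S + ∑ _s : Fin S, ENNReal.ofReal (V / (T * c ^ 2)) := by
        refine add_le_add (h.measure_forall_candidate_le hF hL hσ hD hN hμ hf hmin hΔ hμΔ hB ht
          le_rfl) (Finset.sum_le_sum fun s _ => ?_)
        exact h.measure_estimate_error_le hF hL hσ hD hN hT hμ hf hmin hΔ hμΔ hB ht s.2 hc
    _ = _ := by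
        rw [h2, ENNReal.ofReal_add (by positivity) (by positivity),
          ENNReal.ofReal_pow (by positivity), ENNReal.ofReal_inv_of_pos zero_lt_two,
          ENNReal.ofReal_ofNat, ENNReal.ofReal_mul (by positivity), ENNReal.ofReal_natCast]
        simp

end Draws.IsSampling

end TwoPhases

/-! ### Arithmetic of the parameters -/

section Parameters

variable {n N : ℕ} {L σ μ B Δ : ℝ}

lemma biasBound_sq_le (hN : 1 ≤ N) (hμΔ : μ ^ 2 * (2 * N * (n + 4) ^ 2) ≤ Δ ^ 2) :
    biasBound n L μ ^ 2 ≤ (n + 4) * L ^ 2 * Δ ^ 2 / (8 * N) := by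
  have hN' : (0 : ℝ) < N := by exact_mod_cast hN
  have hn : (0 : ℝ) ≤ n := Nat.cast_nonneg n
  rw [biasBound_sq, le_div_iff₀ (by positivity)]
  have : (n : ℝ) ^ 2 * (n + 2) ≤ (n + 4) ^ 3 := by
    calc (n : ℝ) ^ 2 * (n + 2) ≤ (n + 4) ^ 2 * (n + 4) := by gcongr <;> linarith
      _ = _ := by ring
  calc μ ^ 2 * L ^ 2 / 4 * (n ^ 2 * (n + 2)) * (8 * N)
      ≤ μ ^ 2 * L ^ 2 / 4 * (n + 4) ^ 3 * (8 * N) := by gcongr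
    _ = (n + 4) * L ^ 2 * (μ ^ 2 * (2 * N * (n + 4) ^ 2)) := by ring
    _ ≤ _ := by gcongr

/-- The smoothing term fits into the extra summand because `15/4 ≤ 2(n+4)`. -/
lemma variance_budget_le (hN : 1 ≤ N) (hB : 0 ≤ B)
    (hμΔ : μ ^ 2 * (2 * N * (n + 4) ^ 2) ≤ Δ ^ 2) :
    2 * (n + 2) * (B + σ ^ 2) + 15 / 2 * μ ^ 2 * L ^ 2 * n ^ 3 ≤
      2 * (n + 4) * (B + (n + 4) * L ^ 2 * Δ ^ 2 / N + σ ^ 2) := by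
  have hN' : (0 : ℝ) < N := by exact_mod_cast hN
  have hn : (0 : ℝ) ≤ n := Nat.cast_nonneg n
  have h1 : 2 * ((n : ℝ) + 2) * (B + σ ^ 2) ≤ 2 * (n + 4) * (B + σ ^ 2) := by
    gcongr; norm_num
  have h2 : 15 / 2 * μ ^ 2 * L ^ 2 * (n : ℝ) ^ 3 ≤ 2 * (n + 4) * ((n + 4) * L ^ 2 * Δ ^ 2 / N) := by
    rw [← mul_div_assoc, le_div_iff₀ hN']
    have h3 : (n : ℝ) ^ 3 ≤ (n + 4) ^ 3 := by gcongr; linarith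
    have h4 : 15 / 4 * L ^ 2 * ((n : ℝ) + 4) ≤ 2 * L ^ 2 * (n + 4) * (n + 4) := by
      have : 0 ≤ L ^ 2 * ((n : ℝ) + 4) := by positivity
      nlinarith
    calc 15 / 2 * μ ^ 2 * L ^ 2 * (n : ℝ) ^ 3 * N
        ≤ 15 / 2 * μ ^ 2 * L ^ 2 * (n + 4) ^ 3 * N := by gcongr
      _ = 15 / 4 * L ^ 2 * (n + 4) * (μ ^ 2 * (2 * N * (n + 4) ^ 2)) := by ring
      _ ≤ 2 * L ^ 2 * (n + 4) * (n + 4) * Δ ^ 2 := by gcongr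
      _ = _ := by ring
  linarith

lemma sq_mul_le_of_le_div (hμ : 0 < μ) (hN : 1 ≤ N)
    (h : μ ≤ Δ / (((n : ℝ) + 4) * √(2 * (N : ℝ)))) :
    μ ^ 2 * (2 * N * (n + 4) ^ 2) ≤ Δ ^ 2 := by
  have hN' : (0 : ℝ) < N := by exact_mod_cast hN
  rw [le_div_iff₀ (by positivity)] at h
  have h2 : √(2 * (N : ℝ)) ^ 2 = 2 * N := Real.sq_sqrt (by positivity)
  calc μ ^ 2 * (2 * N * (n + 4) ^ 2) = (μ * ((n + 4) * √(2 * (N : ℝ)))) ^ 2 := by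
        rw [mul_pow, mul_pow, h2]; ring
    _ ≤ Δ ^ 2 := by gcongr

lemma sqrt_add_sq_le_four {x e : ℝ} (hx : 0 ≤ x) :
    (√x + 2 * e) ^ 2 ≤ 4 * x + 6 * e ^ 2 := by
  nlinarith [Real.sq_sqrt hx, sq_nonneg (3 * √x - 2 * e)]

/-- Young's inequality with less weight on `x`, for part (b): with the bounds used there, the
coefficients `4` and `6` would add up to more than `ε`. -/
lemma sqrt_add_sq_le_five_halves {x e : ℝ} (hx : 0 ≤ x) :
    (√x + 2 * e) ^ 2 ≤ 5 / 2 * x + 20 / 3 * e ^ 2 := by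
  nlinarith [Real.sq_sqrt hx, sq_nonneg (3 * √x - 4 * e)]

lemma two_rpow_neg_numRuns_le {Λ : ℝ} (hΛ : 0 < Λ) :
    (2 : ℝ) ^ (-(numRuns Λ : ℝ)) ≤ Λ / 2 := by
  have h3 : Real.logb 2 (2 / Λ) ≤ numRuns Λ := Nat.le_ceil _
  rw [Real.rpow_neg zero_le_two, show Λ / 2 = (2 / Λ)⁻¹ by rw [inv_div]]
  apply inv_anti₀ (by positivity)
  calc 2 / Λ = 2 ^ Real.logb 2 (2 / Λ) :=
        (Real.rpow_logb two_pos (by norm_num) (by positivity)).symm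
    _ ≤ _ := Real.rpow_le_rpow_of_exponent_le one_le_two h3

/-- The first branch of the maximum gives `ε/432`, which enters `L · Bbar` twelvefold as `ε/36`; the
second gives `ε/18`. Together they make `ε/12`. -/
lemma Nhat_spec {D ε : ℝ} (hL : 0 < L) (hD : 0 < D) (hε : 0 < ε) (hN : 1 ≤ N)
    (h : N = Nhat n L σ D Δ ε) :
    (n + 4) * L ^ 2 * Δ ^ 2 / N ≤ ε / 432 ∧ L * Bbar n L σ D Δ N ≤ ε / 12 := by
  have hN' : (0 : ℝ) < N := by exact_mod_cast hN
  have hr : 0 < √(N : ℝ) := by positivity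
  have hmax : max (12 * ((n : ℝ) + 4) * (6 * L * Δ) ^ 2 / ε)
      ((72 * L * √((n : ℝ) + 4) * (D + Δ ^ 2 / D) * (σ / ε)) ^ 2) ≤ (N : ℝ) := by
    rw [h]; exact Nat.le_ceil _
  have h1 : 12 * ((n : ℝ) + 4) * (6 * L * Δ) ^ 2 / ε ≤ N := (le_max_left _ _).trans hmax
  have h2 : (72 * L * √((n : ℝ) + 4) * (D + Δ ^ 2 / D) * (σ / ε)) ^ 2 ≤ (N : ℝ) :=
    (le_max_right _ _).trans hmax
  have h3 : (n + 4) * L ^ 2 * Δ ^ 2 / N ≤ ε / 432 := by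
    rw [div_le_iff₀ hε] at h1
    rw [div_le_iff₀ hN']
    linarith
  refine ⟨h3, ?_⟩
  have h4 : 72 * L * √((n : ℝ) + 4) * (D + Δ ^ 2 / D) * (σ / ε) ≤ √(N : ℝ) :=
    Real.le_sqrt_of_sq_le h2
  have h5 : 4 * L * σ * √((n : ℝ) + 4) / √(N : ℝ) * (D + Δ ^ 2 / D) ≤ ε / 18 := by
    have e : 4 * L * σ * √((n : ℝ) + 4) / √(N : ℝ) * (D + Δ ^ 2 / D) =
        (72 * L * √((n : ℝ) + 4) * (D + Δ ^ 2 / D) * (σ / ε)) * (ε / 18) / √(N : ℝ) := by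
      field_simp
      ring
    rw [e, div_le_iff₀ hr, mul_comm]
    gcongr
  have e : L * Bbar n L σ D Δ N = 12 * ((n + 4) * L ^ 2 * Δ ^ 2 / N) +
      4 * L * σ * √((n : ℝ) + 4) / √(N : ℝ) * (D + Δ ^ 2 / D) := by
    unfold Bbar
    ring
  linarith

/-- Since `σ² ≤ εm/6`, the hypothesis gives `Y ≤ (36 + 1 + 72)/432 · εm`. This is below `3/8 · εm`,
the value at which the lower bound on `T` cancels exactly. -/
lemma That_spec {ε Λ : ℝ} (hε : 0 < ε) (hΛ : 0 < Λ) {S T : ℕ} (hS : S = numRuns Λ)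
    (h : T = That n σ ε Λ) {Y : ℝ} (hY : Y ≤ ε / 12 + ε / 432 + σ ^ 2) :
    1 ≤ T ∧ S * (2 * (n + 4) * Y / (T * (√ε / 4) ^ 2)) ≤ Λ / 2 := by
  set m := max 1 (6 * σ ^ 2 / ε)
  have hm1 : 1 ≤ m := le_max_left _ _
  have hm2 : 6 * σ ^ 2 ≤ ε * m := by
    have : 6 * σ ^ 2 / ε ≤ m := le_max_right _ _
    rw [div_le_iff₀ hε] at this
    linarith
  have hT : 24 * ((n : ℝ) + 4) * ((S : ℝ) + 1) / Λ * m ≤ T := by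
    rw [h, hS]; exact Nat.le_ceil _
  have hpos : 0 < 24 * ((n : ℝ) + 4) * ((S : ℝ) + 1) / Λ * m := by positivity
  have hT0 : (0 : ℝ) < T := hpos.trans_le hT
  refine ⟨by exact_mod_cast hT0, ?_⟩
  have hY2 : Y ≤ ε * m * (109 / 432) := by
    have : ε ≤ ε * m := le_mul_of_one_le_right hε.le hm1
    linarith
  have hs : (√ε / 4) ^ 2 = ε / 16 := by rw [div_pow, Real.sq_sqrt hε.le]; norm_num
  rw [hs, ← mul_div_assoc, div_le_iff₀ (by positivity)]
  calc S * (2 * (n + 4) * Y) ≤ (S + 1) * (2 * (n + 4) * (ε * m * (3 / 8))) := by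
        have hem : 0 ≤ ε * m := by positivity
        have hY3 : Y ≤ ε * m * (3 / 8) := by linarith
        have hS0 : (0 : ℝ) ≤ S := Nat.cast_nonneg S
        have h6 : 0 ≤ 2 * ((n : ℝ) + 4) * (ε * m * (3 / 8)) := by positivity
        calc (S : ℝ) * (2 * (n + 4) * Y) ≤ S * (2 * (n + 4) * (ε * m * (3 / 8))) := by gcongr
          _ ≤ _ := by gcongr; linarith
    _ = Λ / 2 * (24 * ((n : ℝ) + 4) * ((S : ℝ) + 1) / Λ * m * (ε / 16)) := by
        field_simp
        norm_num
    _ ≤ Λ / 2 * (T * (ε / 16)) := by gcongr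

end Parameters

/-! ### The deviation bound and the complexity bound -/

theorem mainTheorem7 {n : ℕ} {Ξ Ω : Type*}
    [MeasurableSpace Ξ] [StandardBorelSpace Ξ] [Nonempty Ξ]
    [MeasurableSpace Ω] (Pr : Measure Ω) [IsProbabilityMeasure Pr]
    (P : Measure Ξ) [IsProbabilityMeasure P]
    (F : EuclideanSpace ℝ (Fin n) → Ξ → ℝ) (hF : Measurable (Function.uncurry F))
    (hFint : ∀ x, Integrable (F x) P)
    (L σ D : ℝ) (hL : 0 < L) (hσ : 0 ≤ σ) (hD : 0 < D)
    (hFsmooth : ∀ᵐ ξ ∂P, IsC11 L (fun x => F x ξ))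
    (hbdd : BddBelow (Set.range (objective F P)))
    (x₁ : EuclideanSpace ℝ (Fin n)) :
    (∀ (S N T : ℕ), 1 ≤ S → 1 ≤ N → 1 ≤ T →
      ∀ μ : ℝ, 0 < μ → μ ≤ Dgap (objective F P) L x₁ / (((n : ℝ) + 4) * √(2 * (N : ℝ))) →
      ∀ d : Draws n Ξ Ω,
        d.IsSampling Pr F (objective F P) L σ (stepsize n L σ D N) S N T →
      ∀ pick : Ω → (Fin S → EuclideanSpace ℝ (Fin n)) → Fin S, IsMinNormPick pick →
      ∀ lam : ℝ, 0 < lam →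
        Pr.real {ω |
          8 * L * Bbar n L σ D (Dgap (objective F P) L x₁) N
            + 3 * ((n : ℝ) + 4) * L ^ 2 * Dgap (objective F P) L x₁ ^ 2 / (2 * N)
            + 24 * ((n : ℝ) + 4) * lam / T *
              (L * Bbar n L σ D (Dgap (objective F P) L x₁) N
                + ((n : ℝ) + 4) * L ^ 2 * Dgap (objective F P) L x₁ ^ 2 / N + σ ^ 2)
          ≤ ‖gradient (objective F P)
              ((twoRSGF (stepsize n L σ D N) μ x₁ S T d ω (pick ω)).output F)‖ ^ 2}
          ≤ ((S : ℝ) + 1) / lam + 2 ^ (-(S : ℝ))) ∧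
    (∀ ε Λ : ℝ, 0 < ε → 0 < Λ → Λ < 1 →
      ∀ S N T : ℕ, S = numRuns Λ → N = Nhat n L σ D (Dgap (objective F P) L x₁) ε →
        T = That n σ ε Λ →
      ∀ μ : ℝ, 0 < μ → μ ≤ Dgap (objective F P) L x₁ / (((n : ℝ) + 4) * √(2 * (N : ℝ))) →
      ∀ d : Draws n Ξ Ω,
        d.IsSampling Pr F (objective F P) L σ (stepsize n L σ D N) S N T →
      ∀ pick : Ω → (Fin S → EuclideanSpace ℝ (Fin n)) → Fin S, IsMinNormPick pick →
        IsEpsLamSolution Pr (objective F P) ε Λ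
          (fun ω => (twoRSGF (stepsize n L σ D N) μ x₁ S T d ω (pick ω)).output F) ∧
        ∀ ω, (twoRSGF (stepsize n L σ D N) μ x₁ S T d ω (pick ω)).calls F ≤ 2 * S * (N + T)) := by
  have hf : IsC11 L (objective F P) := isC11_objective hFint hFsmooth
  set f := objective F P
  have hmin : ∀ y, ⨅ x, f x ≤ f y := fun y => ciInf_le hbdd y
  set Δ := Dgap f L x₁
  have hΔ : L * Δ ^ 2 / 2 = f x₁ - ⨅ x, f x := by
    have h0 : 0 ≤ 2 * (f x₁ - ⨅ x, f x) / L :=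
      div_nonneg (mul_nonneg zero_le_two (sub_nonneg.2 (hmin x₁))) hL.le
    rw [show Δ ^ 2 = 2 * (f x₁ - ⨅ x, f x) / L from Real.sq_sqrt h0]
    field_simp
  have hΔ0 : ∀ (N : ℕ) (μ : ℝ), 0 < μ → μ ≤ Δ / (((n : ℝ) + 4) * √(2 * (N : ℝ))) →
      1 ≤ N ∧ 0 < Δ := by
    intro N μ hμ hle
    have h0 : 0 < Δ / (((n : ℝ) + 4) * √(2 * (N : ℝ))) := hμ.trans_le hle
    constructor
    · by_contra hN
      -- For `N = 0` the bound on `μ` is a division by zero, hence `0`, against `μ > 0`. Part (b)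
      -- gets `1 ≤ N` in this way.
      simp [Nat.lt_one_iff.1 (not_le.1 hN)] at h0
    · by_contra hneg
      exact absurd h0 (not_lt.2 (div_nonpos_of_nonpos_of_nonneg (not_lt.1 hneg) (by positivity)))
  have hB : ∀ N : ℕ, 1 ≤ N → 0 < Δ → 0 < L * Bbar n L σ D Δ N := by
    intro N hN hΔp
    have hN' : (0 : ℝ) < N := by exact_mod_cast hN
    unfold Bbar
    positivity
  constructor
  · intro S N T hS hN hT μ hμ hle d hd pick hpick lam hlam
    have hΔp := (hΔ0 N μ hμ hle).2
    have hμΔ := sq_mul_le_of_le_div hμ hN hle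
    have hBp := hB N hN hΔp
    have hN' : (0 : ℝ) < N := by exact_mod_cast hN
    have hT' : (0 : ℝ) < T := by exact_mod_cast hT
    set B := L * Bbar n L σ D Δ N
    set Y := B + ((n : ℝ) + 4) * L ^ 2 * Δ ^ 2 / N + σ ^ 2
    have hY : 0 < Y := by positivity
    -- Chosen so that each estimate fails with probability at most `1/lam`.
    set c := √(2 * (n + 4) * lam / T * Y)
    have hc : 0 < c := Real.sqrt_pos.2 (by positivity)
    have hc2 : c ^ 2 = 2 * (n + 4) * lam / T * Y := Real.sq_sqrt (by positivity)
    have hV := variance_budget_le (L := L) (σ := σ) hN hBp.le hμΔ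
    have hb := biasBound_sq_le (L := L) hN hμΔ
    have hmain := hd.measureReal_output_le hF hL hσ hD hN hT hμ hf hmin hΔ hμΔ hBp
      hpick.norm_le hc
    refine (measureReal_mono fun ω hω => ?_).trans (hmain.trans ?_)
    · refine le_of_sq_le_sq ?_ (norm_nonneg _)
      refine le_trans ?_ hω
      refine (sqrt_add_sq_le_four (by positivity)).trans ?_
      -- Combined with the factor `6`, this gives `12c²`, the `lam` term, and `12` squared biases,
      -- covered by the term with `3/(2N)`.
      have h1 : (c + biasBound n L μ) ^ 2 ≤ 2 * (c ^ 2 + biasBound n L μ ^ 2) := add_sq_le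
      have e1 : 24 * ((n : ℝ) + 4) * lam / T * Y = 12 * c ^ 2 := by rw [hc2]; ring
      have e2 : 3 * ((n : ℝ) + 4) * L ^ 2 * Δ ^ 2 / (2 * N) =
          12 * ((n + 4) * L ^ 2 * Δ ^ 2 / (8 * N)) := by
        field_simp
        norm_num
      have e3 : 8 * L * Bbar n L σ D Δ N = 8 * B := by ring
      rw [e1, e2, e3]
      linarith
    · rw [hc2, add_comm]
      gcongr ?_ + _
      calc _ ≤ (S : ℝ) * (2 * (n + 4) * Y / (T * (2 * (n + 4) * lam / T * Y))) := by gcongr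
        _ = S / lam := by field_simp
        _ ≤ _ := by gcongr; linarith
  · intro ε Λ hε hΛ hΛ1 S N T hS hNe hTe μ hμ hle d hd pick hpick
    obtain ⟨hN, hΔp⟩ := hΔ0 N μ hμ hle
    refine ⟨?_, fun ω => calls_twoRSGF_le F _ μ x₁ S T N d ω (pick ω) fun s hs => hd.R_mem s hs ω⟩
    have hμΔ := sq_mul_le_of_le_div hμ hN hle
    have hBp := hB N hN hΔp
    have hV := variance_budget_le (L := L) (σ := σ) hN hBp.le hμΔ
    have hb := biasBound_sq_le (L := L) hN hμΔ
    obtain ⟨hN1, hN2⟩ := Nhat_spec hL hD hε hN hNe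
    obtain ⟨hT, hSY⟩ := That_spec (n := n) hε hΛ hS hTe
      (Y := L * Bbar n L σ D Δ N + ((n : ℝ) + 4) * L ^ 2 * Δ ^ 2 / N + σ ^ 2) (by linarith)
    have hT' : (0 : ℝ) < T := by exact_mod_cast hT
    -- Part (b) restarts from the union bound with its own threshold `c = √ε/4`: in (a) with `lam =
    -- 2(S+1)/Λ`, the bounds from `Nhat_spec` and `That_spec` would give only `(2/3 + 1/288 +
    -- 109/216)ε`, which exceeds `ε`.
    have hc : 0 < √ε / 4 := by positivity
    have hc2 : (√ε / 4) ^ 2 = ε / 16 := by rw [div_pow, Real.sq_sqrt hε.le]; norm_num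
    have hmain := hd.measureReal_output_le hF hL hσ hD hN hT hμ hf hmin hΔ hμΔ hBp
      hpick.norm_le hc
    have hS2 := two_rpow_neg_numRuns_le hΛ
    rw [← hS] at hS2
    set out := fun ω => (twoRSGF (stepsize n L σ D N) μ x₁ S T d ω (pick ω)).output F
    set bad := {ω | √(2 * (L * Bbar n L σ D Δ N)) + 2 * (√ε / 4 + biasBound n L μ) ≤
      ‖gradient f (out ω)‖}
    have hbad : Pr.real bad ≤ Λ := by
      refine hmain.trans ?_
      have h1 : (S : ℝ) * ((2 * (n + 2) * (L * Bbar n L σ D Δ N + σ ^ 2)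
          + 15 / 2 * μ ^ 2 * L ^ 2 * n ^ 3) / (T * (√ε / 4) ^ 2)) ≤
          S * (2 * (n + 4) * (L * Bbar n L σ D Δ N
            + ((n : ℝ) + 4) * L ^ 2 * Δ ^ 2 / N + σ ^ 2) / (T * (√ε / 4) ^ 2)) := by
        gcongr
      linarith
    -- Covering the whole space and using subadditivity avoids taking complements of events.
    have hcover : Set.univ ⊆ {ω | ‖gradient f (out ω)‖ ^ 2 ≤ ε} ∪ bad := by
      intro ω _
      by_contra hcon
      rw [Set.mem_union, not_or] at hcon
      have h1 : ε < ‖gradient f (out ω)‖ ^ 2 := not_le.1 hcon.1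
      have h2 : ‖gradient f (out ω)‖ <
          √(2 * (L * Bbar n L σ D Δ N)) + 2 * (√ε / 4 + biasBound n L μ) := not_le.1 hcon.2
      have h3 : ‖gradient f (out ω)‖ ^ 2 <
          (√(2 * (L * Bbar n L σ D Δ N)) + 2 * (√ε / 4 + biasBound n L μ)) ^ 2 := by gcongr
      have h4 := sqrt_add_sq_le_five_halves (x := 2 * (L * Bbar n L σ D Δ N))
        (e := √ε / 4 + biasBound n L μ) (by positivity)
      -- The bias is tiny, so the weight is shifted towards `√ε/4`. The total is `5/12 + (20/3)(5/64
      -- + 5/3456) < 1` in units of `ε`.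
      have h5 : (√ε / 4 + biasBound n L μ) ^ 2 ≤
          5 / 4 * (√ε / 4) ^ 2 + 5 * biasBound n L μ ^ 2 := by
        nlinarith [sq_nonneg (√ε / 4 - 4 * biasBound n L μ)]
      have h6 : biasBound n L μ ^ 2 ≤ ε / 3456 := by
        refine hb.trans ?_
        rw [show ((n : ℝ) + 4) * L ^ 2 * Δ ^ 2 / (8 * N) =
          ((n : ℝ) + 4) * L ^ 2 * Δ ^ 2 / N / 8 by rw [div_div, mul_comm (8 : ℝ)]]
        linarith
      linarith
    have h1 := (measureReal_mono hcover (measure_ne_top Pr _)).trans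
      (measureReal_union_le (μ := Pr) _ _)
    rw [probReal_univ] at h1
    change 1 - Λ ≤ Pr.real {ω | ‖gradient f (out ω)‖ ^ 2 ≤ ε}
    linarith
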